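/- **Setting.** For each $n$ let $Z\in\mathbb R^{n\times p}$ be covariates with rows $z_i'$, and let $X^*\in\mathbb R^{n\times d}$ (rows $x_i^{*\prime}$), $B^*\in\mathbb R^{p\times d}$ (rows $b_j^{*\prime}$) and $\beta^*\in\mathbb R$ be the truth; $p,d\ge 1$, $Z$, $X^*$, $B^*$, $\beta^*$ and $s_x,s_b,K,\delta$ below may all depend on $n$, the constants named below do not. At most $s_x$ indices $i$ have $x_i^*\ne B^{*\prime}z_i$, and at most $s_b$ indices $j$ have $b_j^*\neq 0$. One observes independent $Y_{ij}\sim\mathrm{Bernoulli}\big(1/(1+\exp(-\beta^*-x_i^{*\prime}x_j^*))\big)$, $1\le i\le j\le n$. Put $\epsilon_n=M_0\sqrt{(1+s_b+s_x)\,d\log(np)/n^2}$ with a constant $M_0>0$. **Prior.** Conditionally on independent half-Cauchy$(0,1)$ variables $\tau_b,\lambda_{b_j},\tau_x,\lambda_{x_i}$, $b_j\sim N(0,\lambda_{b_j}^2\tau_b^2 I_d)$ for $j\le p$ and $x_i\mid B\sim N(B'z_i,\lambda_{x_i}^2\tau_x^2I_d)$ for $i\le n$, independently. The resulting law of $X$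 is conditioned on the event $\{\|x_i\|_\infty\le C_5\ \forall i,\ \|\sum_i x_i\|_\infty\le C_6\}$, and $\beta$ is independent of $X$ with law $\Pi_\beta$. For a fixed $\alpha\in(0,1)$, the fractional posterior $\Pi_\alpha(\cdot\mid Y)$ of $(X,\beta)$ is proportional to (likelihood)$^\alpha$ times the prior. **Assumptions.** $\epsilon_n\to0$ and $\log p=O(\log n)$; $\max_i\|x_i^*\|_\infty\le C_1<C_5$, $C_6>0$, $\max_i\|x_i^*\|_2$ is bounded uniformly in $n$ (automatic if $d$ is bounded), and $\max_j\|b_j^*\|_\infty=O(p^{C_2})$ for a constant $C_2>0$; there are constants $\underline c,\overline c,R>0$ such that, for all large $n$, $\underline c\,n\|\tilde B\|_F^2\le\|Z\tilde B\|_F^2\le\overline c\,n\|\tilde B\|_F^2$ for every $\tilde B\in\mathbb R^{p\times d}$ whose rows have Euclidean norms summing to at most $R(1+s_b)d\log(np)$; $\epsilon_n^2=o(e^{\beta^*})$ and $\beta^*$ is bounded above; there are constants $c,c_4>0$ with $\Pi_\beta(|\beta-\beta^*|\le c_4\epsilon_n)\ge c\,e^{-n^2\epsilon_n^2}$ for all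 large $n$; $\sum_i x_i^*=0$. Moreover: 1. $X^*$ has $K$ distinct rows for all large $n$: $X^*=\Xi^*\mathcal C$ with a membership matrix $\Xi^*\in\{0,1\}^{n\times K}$ (exactly one $1$ in each row) and a matrix $\mathcal C\in\mathbb R^{K\times d}$ of distinct centers that has full column rank; 2. the smallest ($d$-th) singular value of $X^*$ is $\Omega(\sqrt n)$; 3. $\delta>0$ and $\|x_i^*-x_j^*\|_2\ge\delta$ whenever $x_i^*\ne x_j^*$; 4. the smallest block of $\Xi^*$ has size $\omega\big(n\,\epsilon_n^2e^{-\beta^*}/\delta^2\big)$. **Conclusion.** Let $\hat X$ be a Bayes estimator of $X$ for the loss $n^{-2}\sum_{i,j}(x_i'x_j-\hat x_i'\hat x_j)^2$, that is, a minimizer over $\mathbb R^{n\times d}$ of the expected loss under $\Pi_\alpha(\cdot\mid Y)$, and let $\hat\Xi$ be the membership matrix of a solution of the $K$-means problem $\min_{\Xi,\,\mathcal C}\|\hat X-\Xi\,\mathcal C\|_F^2$. Let $L(\hat\Xi,\Xi^*)$ be the number of misclustered nodes, i.e. the minimum over all $K\times K$ permutation matrices $J$ of the number of nonzero rows of $\hat\Xi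 J-\Xi^*$. Then there is a constant $C>0$ such that, with probability tending to $1$ as $n\to\infty$, $$\frac1n\,L(\hat\Xi,\Xi^*)\ \le\ C\,\frac{e^{-\beta^*}\epsilon_n^2}{\delta^2}.$$ -/

import Mathlib

open MeasureTheory ProbabilityTheory Filter Topology Asymptotics

noncomputable section

/-- Real matrices with `m` rows and `d` columns, as functions of the row and the column index
(so that they carry the product measurable structure). The row `X i` is a vector of length `d`. -/
abbrev Mat (m d : ℕ) : Type := Fin m → Fin d → ℝ

/-! ### The network model -/

/-- Node pairs `i ≤ j`; self-pairs are observed as well. -/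
abbrev NodePair (n : ℕ) : Type := {e : Fin n × Fin n // e.1 ≤ e.2}

/-- An observed undirected network: `Y e = true` iff the two nodes of the pair `e` are linked. -/
abbrev Network (n : ℕ) : Type := NodePair n → Bool

/-- The log-odds `β + x_i' x_j` of a link between the nodes of the pair `e`. -/
def linkLogit {n d : ℕ} (β : ℝ) (X : Mat n d) (e : NodePair n) : ℝ :=
  β + ∑ k, X e.1.1 k * X e.1.2 k

/-- The law of the network: independent links, the pair `(i, j)` being linked with probability
`1 / (1 + exp (-β - x_i' x_j))`. -/
def networkLaw {n d : ℕ} (β : ℝ) (X : Mat n d) : Measure (Network n) :=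
  Measure.pi fun e => bernoulliMeasure true false (unitInterval.sigmoid (linkLogit β X e))

/-- The likelihood of the parameters `(X, β)` at the observed network `Y`. -/
def likelihood {n d : ℕ} (Y : Network n) (X : Mat n d) (β : ℝ) : ℝ :=
  ∏ e, if Y e then Real.sigmoid (linkLogit β X e) else 1 - Real.sigmoid (linkLogit β X e)

/-! ### The prior and the fractional posterior -/

/-- The standard half-Cauchy law on the nonnegative half-line, the law of `|C|` for a standard
Cauchy variable `C`. -/
def halfCauchy : Measure ℝ := (cauchyMeasure 0 1).map fun x => |x|

/-- The horseshoe law of an `m × d` matrix: conditionally on the global scale `τ` and the row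
scales `λ_1, …, λ_m`, all independent half-Cauchy, the rows are independent and row `i` is
`N(0, λ_i² τ² I_d)`. It is written as the law of `(τ λ_i g_{ik})` with independent standard
normal `g_{ik}`. -/
def horseshoe (m d : ℕ) : Measure (Mat m d) :=
  (halfCauchy.prod ((Measure.pi fun _ : Fin m => halfCauchy).prod
    (Measure.pi fun _ : Fin m => Measure.pi fun _ : Fin d => gaussianReal 0 1))).map
      fun w i k => w.1 * w.2.1 i * w.2.2 i k

/-- The prior of the latent positions given the covariates `Z`: the rows `b_j` of `B` follow the
horseshoe law centred at `0`, and given `B` the rows `x_i` of `X` follow the horseshoe law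
(with its own global and local scales) centred at `B' z_i`. -/
def latentPrior {n p : ℕ} (d : ℕ) (Z : Mat n p) : Measure (Mat n d) :=
  ((horseshoe p d).prod (horseshoe n d)).map
    fun w i k => (∑ j, Z i j * w.1 j k) + w.2 i k

/-- The set of position matrices that are bounded by `C₅` entrywise and whose column sums are
bounded by `C₆`. -/
def boundedCentred (n d : ℕ) (C₅ C₆ : ℝ) : Set (Mat n d) :=
  {X | (∀ i k, |X i k| ≤ C₅) ∧ ∀ k, |∑ i, X i k| ≤ C₆}

/-- The prior of `(X, β)`: the latent prior conditioned on `boundedCentred`, times an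
independent prior of `β`. -/
def jointPrior {n p : ℕ} (d : ℕ) (Z : Mat n p) (C₅ C₆ : ℝ) (priorβ : Measure ℝ) :
    Measure (Mat n d × ℝ) :=
  (cond (latentPrior d Z) (boundedCentred n d C₅ C₆)).prod priorβ

/-- The prior reweighted by the likelihood to the power `α` (not normalised). -/
def fractionalWeight {n d : ℕ} (α : ℝ) (prior : Measure (Mat n d × ℝ)) (Y : Network n) :
    Measure (Mat n d × ℝ) :=
  prior.withDensity fun θ => ENNReal.ofReal (likelihood Y θ.1 θ.2 ^ α)

/-- The `α`-fractional posterior of `(X, β)` given `Y`. -/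
def fractionalPosterior {n d : ℕ} (α : ℝ) (prior : Measure (Mat n d × ℝ)) (Y : Network n) :
    Measure (Mat n d × ℝ) :=
  (fractionalWeight α prior Y Set.univ)⁻¹ • fractionalWeight α prior Y

/-! ### The Bayes estimator -/

/-- The squared error loss for the inner products,
`n⁻² ∑_{i,j} (x_i' x_j - m_i' m_j)²`. -/
def innerProductLoss {n d : ℕ} (X M : Mat n d) : ℝ :=
  (1 / (n : ℝ) ^ 2) * ∑ i, ∑ j, ((∑ k, X i k * X j k) - ∑ k, M i k * M j k) ^ 2

/-- `M` is a Bayes estimate of `X`: it minimises the posterior expected inner-product loss over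
all `n × d` matrices. -/
def IsBayesEstimate {n d : ℕ} (post : Measure (Mat n d × ℝ)) (M : Mat n d) : Prop :=
  ∀ M' : Mat n d,
    ∫ θ, innerProductLoss θ.1 M ∂post ≤ ∫ θ, innerProductLoss θ.1 M' ∂post

/-! ### Memberships, K-means and the misclustering loss -/

/-- `g` is a solution of the K-means problem for the rows of `U`. A membership matrix with `n`
rows and `K` columns is given by its labels `g : Fin n → Fin K` (its row `i` is the unit vector
with index `g i`); the pair of a membership matrix and a `K × d` matrix of centers `C` minimises
the squared Frobenius distance of `U` to their product, whose row `i` is `C (g i)`. -/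
def IsKMeans {n d K : ℕ} (U : Mat n d) (g : Fin n → Fin K) : Prop :=
  ∃ C : Mat K d, ∀ (g' : Fin n → Fin K) (C' : Mat K d),
    ∑ i, ∑ k, (U i k - C (g i) k) ^ 2 ≤ ∑ i, ∑ k, (U i k - C' (g' i) k) ^ 2

/-- The number of misclustered nodes: the least number of nodes on which the two labelings
differ, over all permutations of the labels of the first one. -/
def misclustered {n K : ℕ} (ghat g : Fin n → Fin K) : ℕ :=
  Finset.univ.inf' Finset.univ_nonempty fun σ : Equiv.Perm (Fin K) =>
    (Finset.univ.filter fun i => σ (ghat i) ≠ g i).card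

/-- The size of the smallest block of a labeling. -/
def minBlockSize {n K : ℕ} (g : Fin n → Fin K) : ℕ :=
  ⨅ k : Fin K, (Finset.univ.filter fun i => g i = k).card

/-! ### Matrix quantities and the rate -/

/-- The squared Frobenius norm. -/
def frobSq {m d : ℕ} (A : Mat m d) : ℝ := ∑ i, ∑ k, A i k ^ 2

/-- The sum of the Euclidean norms of the rows. -/
def norm21 {m d : ℕ} (A : Mat m d) : ℝ := ∑ i, √(∑ k, A i k ^ 2)

/-- The matrix product. -/
def matMul {n p d : ℕ} (Z : Mat n p) (B : Mat p d) : Mat n d :=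
  fun i k => ∑ j, Z i j * B j k

/-- The smallest (the `d`-th largest) singular value of a matrix with `d` columns; singular
values are indexed from zero, in decreasing order. -/
def smallestSingularValue {n d : ℕ} (X : Mat n d) : ℝ :=
  (Matrix.toEuclideanLin (Matrix.of X)).singularValues (d - 1)

/-- The rate `ε_n = M₀ √((1 + s_b + s_x) d log (n p) / n²)`. -/
def epsRate (M₀ : ℝ) (n p d sb sx : ℕ) : ℝ :=
  M₀ * √((1 + (sb : ℝ) + sx) * d * Real.log ((n : ℝ) * p) / (n : ℝ) ^ 2)

end

/-! ### Small balls of the horseshoe law -/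

/-! The proof has a statistical half, which bounds the Frobenius error of the Gram matrix of the
Bayes estimate, and a deterministic half, which turns that bound into a count of misclustered nodes.

Statistical half. Since `α < 1`, the expectation under the truth of (likelihood ratio)^α is an
affinity. It is at most `exp (-H)`, where `H` is proportional to `e^β` times (`n²` · loss minus a
bounded term). Fubini and Markov then bound the exponential moment of `H` under the unnormalised
fractional posterior, without tests or sieves. The normalising constant is bounded below through a
prior neighbourhood of mass `exp (-r)`, with `r` of order `n² ε_n²`, on which the chi-square
divergence from the truth is controlled (`fractional_posterior_concentration`). The horseshoe
provides this mass: a tiny global scale shrinks all inactive rows at once, and the Cauchy tails of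
the local scales free each active row at a polynomial price (`horseshoe_smallBall`). An error in the
intercept cannot mask an error in the positions, because the true positions are centred and the
prior restricts the column sums (`sum_min_sq_ge`). The Bayes estimate inherits the rate because the
truth competes in the minimisation that defines it (`bayes_loss_concentration`).

Deterministic half. Let `U` be the estimate, `X` the truth, `D = UUᵀ - XXᵀ`, and `σ` a lower bound
of order `n` for the squared smallest singular value of `X`. The explicit matrix `Q = Uᵀ X (XᵀX)⁻¹`
satisfies `UQ - X = D X (XᵀX)⁻¹`, so its squared error is at most `‖D‖² / σ`, and `Q` distorts
squared lengths by factors within `[1/2, 3/2]` (`exists_linear_alignment`). The K-means objective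
therefore changes only by constants under `Qᵀ`, and comparison with the true clustering places the
fitted centers close to the true rows (`kmeans_centers_close`). Counting the rows further than `δ/2`
from their fitted center finishes the proof, since every block has a row that is not among them
(`misclustered_le`). -/

theorem withDensity_Icc_ge {f : ℝ → ENNReal} {c x y : ℝ} (hc : 0 ≤ c)
    (hf : ∀ t ∈ Set.Icc x y, ENNReal.ofReal c ≤ f t) :
    ENNReal.ofReal (c * (y - x)) ≤ volume.withDensity f (Set.Icc x y) := by
  rw [withDensity_apply _ measurableSet_Icc, ENNReal.ofReal_mul hc, ← Real.volume_Icc,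
    ← setLIntegral_const]
  exact setLIntegral_mono' measurableSet_Icc hf

instance : IsProbabilityMeasure halfCauchy :=
  Measure.isProbabilityMeasure_map (by fun_prop)

theorem halfCauchy_Icc_ge {x ρ : ℝ} (hx : 0 < x) (hρ1 : ρ ≤ 1) :
    x * ρ / (4 * (1 + 4 * x ^ 2)) ≤ halfCauchy.real (Set.Icc x (x * (1 + ρ))) := by
  refine (ENNReal.ofReal_le_iff_le_toReal (measure_ne_top _ _)).1 ?_
  rw [halfCauchy, Measure.map_apply (by fun_prop) measurableSet_Icc,
    cauchyMeasure_of_scale_ne_zero _ one_ne_zero]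
  have h1 : Set.Icc x (x * (1 + ρ)) ⊆ (fun x : ℝ => |x|) ⁻¹' Set.Icc x (x * (1 + ρ)) := by
    intro t ht
    simpa [abs_of_pos (hx.trans_le ht.1)] using ht
  refine le_trans ?_ (measure_mono h1)
  have h2 := withDensity_Icc_ge (f := cauchyPDF 0 1) (c := 1 / (4 * (1 + 4 * x ^ 2)))
    (x := x) (y := x * (1 + ρ)) (by positivity) ?_
  · refine le_trans (le_of_eq ?_) h2
    congr 1
    ring
  · intro t ht
    refine ENNReal.ofReal_le_ofReal ?_
    rw [cauchyPDFReal_def, NNReal.coe_one, mul_one, ← mul_inv, one_div]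
    have ht2 : t ≤ 2 * x := by nlinarith [ht.2]
    have ht0 : 0 < t := hx.trans_le ht.1
    have h4 : (t - 0) ^ 2 + 1 ^ 2 ≤ 1 + 4 * x ^ 2 := by nlinarith
    have h5 : 0 < (t - 0) ^ 2 + 1 ^ 2 := by positivity
    exact inv_anti₀ (by positivity) (mul_le_mul Real.pi_le_four h4 h5.le (by norm_num))

/-- The mass is `(2/π) arctan L`, and `arctan L = π/2 - arctan L⁻¹ ≥ π/2 - L⁻¹`. -/
theorem halfCauchy_symm_Icc_ge {L : ℝ} (hL : 0 < L) :
    1 - 1 / L ≤ halfCauchy.real (Set.Icc (-L) L) := by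
  refine (ENNReal.ofReal_le_iff_le_toReal (measure_ne_top _ _)).1 ?_
  rw [halfCauchy, Measure.map_apply (by fun_prop) measurableSet_Icc,
    cauchyMeasure_of_scale_ne_zero _ one_ne_zero]
  have h1 : Set.Icc (-L) L ⊆ (fun x : ℝ => |x|) ⁻¹' Set.Icc (-L) L := by
    intro t ht
    exact ⟨by linarith [abs_nonneg t], abs_le.2 ht⟩
  refine le_trans ?_ (measure_mono h1)
  rw [withDensity_apply _ measurableSet_Icc]
  simp only [cauchyPDF]
  rw [← ofReal_integral_eq_lintegral_ofReal (integrable_cauchyPDFReal 0).integrableOn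
    (ae_of_all _ fun x => (cauchyPDF_pos 0 one_ne_zero x).le)]
  refine ENNReal.ofReal_le_ofReal ?_
  rw [integral_Icc_eq_integral_Ioc, ← intervalIntegral.integral_of_le (by linarith)]
  have h2 : (cauchyPDFReal 0 1) = fun x => Real.pi⁻¹ * (1 + x ^ 2)⁻¹ := by
    ext x
    rw [cauchyPDFReal_def']
    simp
  rw [h2, intervalIntegral.integral_const_mul, integral_inv_one_add_sq, Real.arctan_neg]
  have h3 := Real.arctan_inv_of_pos hL
  have h4 : Real.arctan L⁻¹ ≤ L⁻¹ := by
    have h := Real.le_tan (Real.arctan_nonneg.2 (inv_nonneg.2 hL.le)) (Real.arctan_lt_pi_div_two _)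
    rwa [Real.tan_arctan] at h
  have h5 : Real.pi / 2 - L⁻¹ ≤ Real.arctan L := by linarith
  have h6 : Real.pi⁻¹ * (Real.pi - 2 * L⁻¹) ≤ Real.pi⁻¹ * (Real.arctan L - -Real.arctan L) := by
    refine mul_le_mul_of_nonneg_left ?_ (by positivity)
    linarith
  refine le_trans ?_ h6
  rw [mul_sub, inv_mul_cancel₀ Real.pi_ne_zero, one_div]
  have h7 : Real.pi⁻¹ * 2 ≤ 1 := by
    rw [inv_mul_le_iff₀ Real.pi_pos]
    linarith [Real.two_le_pi]
  have : Real.pi⁻¹ * (2 * L⁻¹) ≤ 1 * L⁻¹ := by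
    rw [← mul_assoc]
    gcongr
  linarith

/-- The interval stays inside `[-2, 2]`, where the density is at least `(1/3)(1/8)`. -/
theorem gaussianReal_Icc_ge {v h : ℝ} (hv : |v| ≤ 1) (h1 : h ≤ 1) :
    h / 12 ≤ (gaussianReal 0 1).real (Set.Icc (v - h) (v + h)) := by
  refine (ENNReal.ofReal_le_iff_le_toReal (measure_ne_top _ _)).1 ?_
  rw [gaussianReal_of_var_ne_zero _ one_ne_zero]
  have h2 := withDensity_Icc_ge (f := gaussianPDF 0 1) (c := 1 / 24)
    (x := v - h) (y := v + h) (by positivity) ?_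
  · refine le_trans (le_of_eq ?_) h2
    congr 1
    ring
  · intro t ht
    refine ENNReal.ofReal_le_ofReal ?_
    rw [gaussianPDFReal]
    simp only [NNReal.coe_one, mul_one, sub_zero]
    have ht2 : |t| ≤ 2 := by
      rw [abs_le] at hv ⊢
      constructor <;> linarith [ht.1, ht.2]
    have ht3 : t ^ 2 ≤ 4 := by
      rw [← sq_abs]; nlinarith [abs_nonneg t]
    have e1 : (8 : ℝ)⁻¹ ≤ Real.exp (-t ^ 2 / 2) := by
      have : Real.exp (-2) ≤ Real.exp (-t ^ 2 / 2) := Real.exp_le_exp.2 (by linarith)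
      refine le_trans ?_ this
      rw [Real.exp_neg]
      gcongr
      have := Real.exp_one_lt_d9
      have h3 : Real.exp 2 = Real.exp 1 ^ 2 := by rw [← Real.exp_nat_mul]; norm_num
      rw [h3]
      nlinarith [Real.exp_pos 1]
    have e2 : (3 : ℝ)⁻¹ ≤ (√(2 * Real.pi))⁻¹ := by
      gcongr
      rw [Real.sqrt_le_left (by norm_num)]
      linarith [Real.pi_le_four]
    calc (1 / 24 : ℝ) = 3⁻¹ * 8⁻¹ := by norm_num
      _ ≤ _ := by gcongr

theorem gaussianReal_symm_Icc_ge {L : ℝ} (hL : 0 < L) :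
    1 - 1 / L ^ 2 ≤ (gaussianReal 0 1).real (Set.Icc (-L) L) := by
  have h := meas_ge_le_variance_div_sq (μ := gaussianReal 0 1) (X := id)
    (memLp_id_gaussianReal 2) hL
  rw [variance_id_gaussianReal] at h
  have hm : ∫ x, id x ∂(gaussianReal 0 1) = 0 := by simp
  rw [hm] at h
  have h2 : (Set.Icc (-L) L)ᶜ ⊆ {x : ℝ | L ≤ |id x - 0|} := by
    intro x hx
    simp only [Set.mem_compl_iff, Set.mem_Icc, ← abs_le, not_le] at hx
    simpa using hx.le
  have h3 : (gaussianReal 0 1).real (Set.Icc (-L) L)ᶜ ≤ 1 / L ^ 2 := by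
    have := (measure_mono h2).trans h
    refine ENNReal.toReal_le_of_le_ofReal (by positivity) ?_
    simpa using this
  rw [probReal_compl_eq_one_sub measurableSet_Icc] at h3
  linarith

/-- Only the exceptional indices are paid for: by Bernoulli's inequality all the others together
cost a factor `1/2`. -/
theorem prod_ite_ge {m s : ℕ} (P : Fin m → Prop) [DecidablePred P] {x q : ℝ} (hx : 0 ≤ x)
    (hx1 : x ≤ 1) (hq : 0 ≤ q) (hq1 : q ≤ 1) (hs : (Finset.univ.filter P).card ≤ s)
    (hm : m * q ≤ 1 / 2) :
    x ^ s / 2 ≤ ∏ i, if P i then x else 1 - q := by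
  rw [Finset.prod_ite, Finset.prod_const, Finset.prod_const]
  have h1 : x ^ s ≤ x ^ (Finset.univ.filter P).card := pow_le_pow_of_le_one hx hx1 hs
  have h2 : (1 / 2 : ℝ) ≤ (1 - q) ^ (Finset.univ.filter fun i => ¬ P i).card := by
    have h3 : (1 - q) ^ m ≤ (1 - q) ^ (Finset.univ.filter fun i => ¬ P i).card := by
      refine pow_le_pow_of_le_one (by linarith) (by linarith) ?_
      exact (Finset.card_le_univ _).trans (by simp)
    have h4 := one_add_mul_le_pow (a := -q) (by linarith) m
    have h5 : (1 : ℝ) + -q = 1 - q := by ring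
    rw [h5] at h4
    linarith
  calc x ^ s / 2 = x ^ s * (1 / 2) := by ring
    _ ≤ _ := by gcongr

theorem pi_real_pi {ι : Type*} [Fintype ι] {E : ι → Type*} [∀ i, MeasurableSpace (E i)]
    (μ : ∀ i, Measure (E i)) [∀ i, SigmaFinite (μ i)] (s : ∀ i, Set (E i)) :
    (Measure.pi μ).real (Set.univ.pi s) = ∏ i, (μ i).real (s i) := by
  simp [Measure.real, Measure.pi_pi, ENNReal.toReal_prod]

instance (m d : ℕ) : IsProbabilityMeasure (horseshoe m d) := by
  refine Measure.isProbabilityMeasure_map (Measurable.aemeasurable ?_)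
  fun_prop

theorem horseshoe_box_le {m d : ℕ} (s : Set ℝ) (l : Fin m → Set ℝ) (w : Fin m → Fin d → Set ℝ)
    {T : Set (Mat m d)} (hT : MeasurableSet T)
    (h : ∀ τ ∈ s, ∀ lam : Fin m → ℝ, (∀ i, lam i ∈ l i) → ∀ v : Mat m d, (∀ i k, v i k ∈ w i k) →
      (fun i k => τ * lam i * v i k) ∈ T) :
    halfCauchy.real s * ((∏ i, halfCauchy.real (l i)) *
      ∏ i, ∏ k, (gaussianReal 0 1).real (w i k)) ≤ (horseshoe m d).real T := by
  rw [horseshoe, map_measureReal_apply (by fun_prop) hT]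
  simp_rw [← pi_real_pi]
  rw [← measureReal_prod_prod, ← measureReal_prod_prod]
  refine measureReal_mono ?_
  rintro ⟨τ, lam, v⟩ ⟨h1, h2, h3⟩
  exact h τ h1 lam (fun i => h2 i trivial) v fun i k => h3 i trivial k trivial

theorem measurableSet_entrywise_ball {m d : ℕ} (U : Mat m d) (r : ℝ) :
    MeasurableSet {V : Mat m d | ∀ i k, |V i k - U i k| ≤ r} := by
  have : {V : Mat m d | ∀ i k, |V i k - U i k| ≤ r} = ⋂ i, ⋂ k, {V | |V i k - U i k| ≤ r} := by
    ext; simp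
  rw [this]
  exact MeasurableSet.iInter fun i => MeasurableSet.iInter fun k =>
    measurableSet_le (by fun_prop) measurable_const

/-- For an active row the product of scales is kept near `A`, an upper bound for the target entries.
The Gaussian factor then only has to be near `u / A`, which lies in `[-1, 1]` where the normal
density is not small. -/
theorem horseshoe_row_close {A T ρ h u τ l v : ℝ} (hA1 : 1 ≤ A) (hT0 : 0 < T) (hρ0 : 0 ≤ ρ)
    (hρ1 : ρ ≤ 1) (hρ2 : 12 * (A * ρ) ≤ A⁻¹) (hAh : A * h ≤ A⁻¹ / 2) (hu : |u| ≤ A)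
    (hτ : τ ∈ Set.Icc T⁻¹ (T⁻¹ * (1 + ρ))) (hl : l ∈ Set.Icc (A * T) (A * T * (1 + ρ)))
    (hv : v ∈ Set.Icc (u / A - h) (u / A + h)) : |τ * l * v - u| ≤ A⁻¹ := by
  have hA0 : 0 < A := by linarith
  have hκ1 : A ≤ τ * l := by
    calc A = T⁻¹ * (A * T) := by field_simp
      _ ≤ _ := mul_le_mul hτ.1 hl.1 (by positivity) (le_trans (by positivity) hτ.1)
  have hκ2 : τ * l ≤ A + 3 * (A * ρ) := by
    calc τ * l ≤ (T⁻¹ * (1 + ρ)) * (A * T * (1 + ρ)) :=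
          mul_le_mul hτ.2 hl.2 (le_trans (by positivity) hl.1) (by positivity)
      _ = A * (1 + 2 * ρ + ρ * ρ) := by field_simp; ring
      _ ≤ A * (1 + 2 * ρ + 1 * ρ) := by gcongr
      _ = _ := by ring
  have hg : |v - u / A| ≤ h := by
    rw [abs_le]; constructor <;> linarith [hv.1, hv.2]
  have huA : |u / A| ≤ 1 := by
    rwa [abs_div, abs_of_pos hA0, div_le_one hA0]
  have hAi : A⁻¹ ≤ 1 := inv_le_one_of_one_le₀ hA1
  have hh : h ≤ 1 := by
    by_contra hc
    push Not at hc
    nlinarith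
  have hv2 : |v| ≤ 2 := by
    calc |v| = |(v - u / A) + u / A| := by ring_nf
      _ ≤ _ := (abs_add_le _ _)
      _ ≤ 2 := by linarith
  calc |τ * l * v - u|
      = |(τ * l - A) * v + A * (v - u / A)| := by
        congr 1; field_simp; ring
    _ ≤ |τ * l - A| * |v| + A * |v - u / A| := by
        refine (abs_add_le _ _).trans ?_
        rw [abs_mul, abs_mul, abs_of_pos hA0]
    _ ≤ 3 * (A * ρ) * 2 + A * h := by
        have h1 : |τ * l - A| ≤ 3 * (A * ρ) := by rw [abs_of_nonneg (by linarith)]; linarith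
        gcongr
    _ ≤ A⁻¹ := by linarith

/-- Take `τ ≈ 1/T` with `T` a large power of `N`. Inactive rows then only need `λ` and `g` in `[-2N,
2N]`, an event whose probability over all these rows is bounded below. An active row needs `λ ≈ A
T`, which the Cauchy tail makes polynomially likely, and `d` Gaussian entries in polynomially small
windows. The price is a power of `N` with exponent of order `(1 + s) d`. -/
theorem horseshoe_smallBall {m d N a s : ℕ} (hN : 2 ≤ N) (hd : 0 < d) (hm : m ≤ N) (hdN : d ≤ N)
    (U : Mat m d) (hU : ∀ i k, |U i k| ≤ (N : ℝ) ^ a)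
    (hs : (Finset.univ.filter fun i => U i ≠ 0).card ≤ s) :
    ((N : ℝ) ^ ((8 * a + 30) * ((1 + s) * d)))⁻¹ ≤
      (horseshoe m d).real {V | ∀ i k, |V i k - U i k| ≤ ((N : ℝ) ^ a)⁻¹} := by
  classical
  have hN2 : (2 : ℝ) ≤ N := by exact_mod_cast hN
  have hN0 : (0 : ℝ) < N := by linarith
  have hN1 : (1 : ℝ) ≤ N := by linarith
  have hN5 : (32 : ℝ) ≤ (N : ℝ) ^ 5 := by
    calc (32 : ℝ) = 2 ^ 5 := by norm_num
      _ ≤ _ := by gcongr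
  have hN4 : (16 : ℝ) ≤ (N : ℝ) ^ 4 := by
    calc (16 : ℝ) = 2 ^ 4 := by norm_num
      _ ≤ _ := by gcongr
  set A : ℝ := (N : ℝ) ^ a with hA
  have hA1 : 1 ≤ A := one_le_pow₀ hN1
  have hA0 : 0 < A := by linarith
  -- The extra `N ^ 5` absorbs the `8 N²` that arises for inactive rows from `τ ≤ 2/T` and `|λ|, |g|
  -- ≤ 2N`.
  set T : ℝ := (N : ℝ) ^ (a + 5) with hT
  have hTA : T = A * (N : ℝ) ^ 5 := pow_add _ _ _
  have hT1 : 1 ≤ T := one_le_pow₀ hN1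
  have hT0 : 0 < T := by linarith
  set ρ : ℝ := ((N : ℝ) ^ (2 * a + 4))⁻¹ with hρ
  have hρA : ρ = (A ^ 2 * (N : ℝ) ^ 4)⁻¹ := by rw [hρ, hA, ← pow_mul, ← pow_add, mul_comm 2 a]
  have hρ0 : 0 < ρ := by positivity
  have hρ1 : ρ ≤ 1 := inv_le_one_of_one_le₀ (one_le_pow₀ hN1)
  have hρ2 : 12 * (A * ρ) ≤ A⁻¹ := by
    rw [hρA]
    have : A * (A ^ 2 * (N : ℝ) ^ 4)⁻¹ = A⁻¹ * ((N : ℝ) ^ 4)⁻¹ := by field_simp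
    rw [this]
    have h16 : ((N : ℝ) ^ 4)⁻¹ ≤ 16⁻¹ := by gcongr
    have : 0 < A⁻¹ := by positivity
    nlinarith
  set h : ℝ := A⁻¹ / (2 * A) with hh
  have hh0 : 0 < h := by positivity
  have hAi : A⁻¹ ≤ 1 := inv_le_one_of_one_le₀ hA1
  have hAh : A * h = A⁻¹ / 2 := by rw [hh]; field_simp
  have hh1 : h ≤ 1 := by
    rw [hh, div_le_one (by positivity)]
    linarith
  -- A common lower bound for the probability of each constrained factor: the global scale, an
  -- active local scale, and an active Gaussian entry.
  set x : ℝ := ((N : ℝ) ^ (4 * a + 14))⁻¹ with hx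
  have hx0 : 0 < x := by positivity
  have hx1 : x ≤ 1 := inv_le_one_of_one_le₀ (one_le_pow₀ hN1)
  have hxA : x = (A ^ 4 * (N : ℝ) ^ 14)⁻¹ := by rw [hx, hA, ← pow_mul, ← pow_add, mul_comm 4 a]
  -- the three kinds of factors
  have hτ : x ≤ halfCauchy.real (Set.Icc T⁻¹ (T⁻¹ * (1 + ρ))) := by
    refine le_trans ?_ (halfCauchy_Icc_ge (by positivity) hρ1)
    have hTi : T⁻¹ ≤ 1 := inv_le_one_of_one_le₀ hT1
    have : 4 * (1 + 4 * T⁻¹ ^ 2) ≤ (N : ℝ) ^ 5 := by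
      have : T⁻¹ ^ 2 ≤ 1 := pow_le_one₀ (by positivity) hTi
      linarith
    calc x ≤ T⁻¹ * ρ / (N : ℝ) ^ 5 := by
          rw [hxA, hTA, hρA, ← mul_inv, div_eq_mul_inv, ← mul_inv]
          refine inv_anti₀ (by positivity) ?_
          have : A * (N : ℝ) ^ 5 * (A ^ 2 * (N : ℝ) ^ 4) * (N : ℝ) ^ 5 = A ^ 3 * (N : ℝ) ^ 14 := by
            ring
          rw [this]
          exact mul_le_mul_of_nonneg_right (pow_le_pow_right₀ hA1 (by norm_num)) (by positivity)
      _ ≤ _ := by gcongr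
  have hlam : x ≤ halfCauchy.real (Set.Icc (A * T) (A * T * (1 + ρ))) := by
    refine le_trans ?_ (halfCauchy_Icc_ge (by positivity) hρ1)
    have hAT : 1 ≤ A * T := one_le_mul_of_one_le_of_one_le hA1 hT1
    have : 4 * (1 + 4 * (A * T) ^ 2) ≤ (N : ℝ) ^ 5 * (A * T) ^ 2 := by
      have : 1 ≤ (A * T) ^ 2 := one_le_pow₀ hAT
      nlinarith
    calc x = A * T * ρ / ((N : ℝ) ^ 5 * (A * T) ^ 2) := by
          rw [hxA, hTA, hρA]
          field_simp
      _ ≤ _ := by gcongr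
  have hg : ∀ i k, x ≤ (gaussianReal 0 1).real (Set.Icc (U i k / A - h) (U i k / A + h)) := by
    intro i k
    refine le_trans ?_ (gaussianReal_Icc_ge ?_ hh1)
    · have : h / 12 = (24 * A ^ 2)⁻¹ := by rw [hh]; field_simp; norm_num
      rw [this, hxA]
      refine inv_anti₀ (by positivity) ?_
      calc 24 * A ^ 2 ≤ (N : ℝ) ^ 5 * A ^ 2 :=
            mul_le_mul_of_nonneg_right (by linarith) (by positivity)
        _ ≤ (N : ℝ) ^ 14 * A ^ 4 :=
            mul_le_mul (pow_le_pow_right₀ hN1 (by norm_num)) (pow_le_pow_right₀ hA1 (by norm_num))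
              (by positivity) (by positivity)
        _ = _ := mul_comm _ _
    · rw [abs_div, abs_of_pos hA0, div_le_one hA0]
      exact hU i k
  -- the box
  let l : Fin m → Set ℝ := fun i =>
    if U i ≠ 0 then Set.Icc (A * T) (A * T * (1 + ρ)) else Set.Icc (-(2 * N)) (2 * N)
  let w : Fin m → Fin d → Set ℝ := fun i k =>
    if U i ≠ 0 then Set.Icc (U i k / A - h) (U i k / A + h) else Set.Icc (-(2 * N)) (2 * N)
  refine le_trans ?_ (horseshoe_box_le (Set.Icc T⁻¹ (T⁻¹ * (1 + ρ))) l w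
    (measurableSet_entrywise_ball U _) ?_)
  · have hl : x ^ s / 2 ≤ ∏ i, halfCauchy.real (l i) := by
      refine (prod_ite_ge (fun i => U i ≠ 0) (q := 1 / (2 * N)) hx0.le hx1 (by positivity) ?_ hs
        ?_).trans (Finset.prod_le_prod (fun i _ => ?_) fun i _ => ?_)
      · rw [div_le_one (by positivity)]; linarith
      · have : (m : ℝ) ≤ N := by exact_mod_cast hm
        rw [mul_one_div, div_le_div_iff₀ (by positivity) (by norm_num)]
        linarith
      · split_ifs
        · exact hx0.le
        · rw [sub_nonneg, div_le_one (by positivity)]; linarith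
      · simp only [l]
        split_ifs
        · exact hlam
        · exact halfCauchy_symm_Icc_ge (by positivity)
    have hw : (x ^ d) ^ s / 2 ≤ ∏ i, ∏ k, (gaussianReal 0 1).real (w i k) := by
      have hdN' : (d : ℝ) ≤ N := by exact_mod_cast hdN
      have hmN' : (m : ℝ) ≤ N := by exact_mod_cast hm
      have hq1 : (d : ℝ) * (1 / (2 * N) ^ 2) ≤ 1 / (4 * N) := by
        rw [mul_one_div, div_le_div_iff₀ (by positivity) (by positivity)]
        nlinarith
      have hq2 : (1 : ℝ) / (2 * N) ^ 2 ≤ 1 := by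
        rw [div_le_one (by positivity)]; nlinarith
      have hq3 : (1 : ℝ) / (4 * N) ≤ 1 := by
        rw [div_le_one (by positivity)]; linarith
      refine (prod_ite_ge (fun i => U i ≠ 0) (q := d * (1 / (2 * N) ^ 2)) (x := x ^ d)
        (by positivity) (pow_le_one₀ hx0.le hx1) (by positivity) (hq1.trans hq3) hs
        ?_).trans (Finset.prod_le_prod (fun i _ => ?_) fun i _ => ?_)
      · calc (m : ℝ) * (d * (1 / (2 * N) ^ 2)) ≤ N * (1 / (4 * N)) := by gcongr
          _ = 1 / 4 := by field_simp
          _ ≤ 1 / 2 := by norm_num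
      · split_ifs
        · positivity
        · linarith
      · have hc : (if U i ≠ 0 then x ^ d else 1 - d * (1 / (2 * N : ℝ) ^ 2)) ≤
            ∏ _k : Fin d, if U i ≠ 0 then x else 1 - 1 / (2 * N : ℝ) ^ 2 := by
          rw [Finset.prod_const, Finset.card_univ, Fintype.card_fin]
          split_ifs
          · exact le_rfl
          · have := one_add_mul_le_pow (a := -(1 / (2 * N : ℝ) ^ 2)) (by linarith) d
            rw [← sub_eq_add_neg] at this
            linarith
        refine hc.trans (Finset.prod_le_prod (fun k _ => ?_) fun k _ => ?_)
        · split_ifs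
          · exact hx0.le
          · linarith
        · simp only [w]
          split_ifs
          · exact hg i k
          · exact gaussianReal_symm_Icc_ge (by positivity)
    have hN2' : ((N : ℝ) ^ 2)⁻¹ ≤ 1 / 4 := by
      rw [one_div]
      exact inv_anti₀ (by norm_num) (by nlinarith)
    -- The `2` pays for the two factors `1/2` of the inactive rows, as `N ^ 2 ≥ 4`; then come one
    -- global scale, `s` local scales and `d * s` Gaussian entries, each at price `x`.
    have hexp : 2 + (4 * a + 14) * (1 + s + d * s) ≤ (8 * a + 30) * ((1 + s) * d) := by
      have h1 : 1 + s + d * s ≤ 2 * ((1 + s) * d) := by nlinarith [Nat.zero_le s]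
      have h2 : 1 ≤ (1 + s) * d := Nat.mul_pos (by omega) hd
      have h3 := Nat.mul_le_mul_left (4 * a + 14) h1
      linarith
    have hpow : ((N : ℝ) ^ ((8 * a + 30) * ((1 + s) * d)))⁻¹ ≤
        ((N : ℝ) ^ 2)⁻¹ * (x * (x ^ s * (x ^ d) ^ s)) := by
      refine (inv_anti₀ (by positivity) (pow_le_pow_right₀ hN1 hexp)).trans_eq ?_
      rw [pow_add, pow_mul, mul_inv, ← inv_pow _ (1 + s + d * s), ← hx, pow_add, pow_add, pow_one,
        pow_mul, mul_assoc]
    refine hpow.trans ?_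
    calc ((N : ℝ) ^ 2)⁻¹ * (x * (x ^ s * (x ^ d) ^ s))
        ≤ 1 / 4 * (x * (x ^ s * (x ^ d) ^ s)) := mul_le_mul_of_nonneg_right hN2' (by positivity)
      _ = x * (x ^ s / 2 * ((x ^ d) ^ s / 2)) := by ring
      _ ≤ _ := mul_le_mul hτ (mul_le_mul hl hw (by positivity) (le_trans (by positivity) hl))
        (by positivity) measureReal_nonneg
  · intro τ hτ lam hlam v hv i k
    have hτ0 : 0 ≤ τ := le_trans (by positivity) hτ.1
    have hl := hlam i
    have hwk := hv i k
    simp only [l, w] at hl hwk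
    by_cases hi : U i = 0
    · rw [if_neg (by simpa using hi)] at hl hwk
      have hτ2 : τ ≤ T⁻¹ * 2 :=
        hτ.2.trans (mul_le_mul_of_nonneg_left (by linarith) (by positivity))
      have h8 : T⁻¹ * 2 * (2 * N) * (2 * N) ≤ A⁻¹ := by
        have : (8 : ℝ) * (N : ℝ) ^ 2 ≤ (N : ℝ) ^ 5 := by
          have : (8 : ℝ) ≤ (N : ℝ) ^ 3 := by
            calc (8 : ℝ) = 2 ^ 3 := by norm_num
              _ ≤ _ := by gcongr
          calc 8 * (N : ℝ) ^ 2 ≤ (N : ℝ) ^ 3 * (N : ℝ) ^ 2 := by gcongr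
            _ = _ := by ring
        rw [hTA, mul_inv]
        calc A⁻¹ * ((N : ℝ) ^ 5)⁻¹ * 2 * (2 * N) * (2 * N)
            = A⁻¹ * (((N : ℝ) ^ 5)⁻¹ * (8 * (N : ℝ) ^ 2)) := by ring
          _ ≤ A⁻¹ * 1 := by
            refine mul_le_mul_of_nonneg_left ?_ (by positivity)
            rwa [inv_mul_le_iff₀ (by positivity), mul_one]
          _ = _ := mul_one _
      rw [hi, Pi.zero_apply, sub_zero, abs_mul, abs_mul, abs_of_nonneg hτ0]
      refine le_trans ?_ h8
      exact mul_le_mul (mul_le_mul hτ2 (abs_le.2 hl) (abs_nonneg _) (by positivity))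
        (abs_le.2 hwk) (abs_nonneg _) (by positivity)
    · rw [if_pos hi] at hl hwk
      exact horseshoe_row_close hA1 hT0 hρ0.le hρ1 hρ2 hAh.le (hU i k) hτ hl hwk

/-! ### Divergences between Bernoulli laws with given log-odds -/

theorem sigmoid_add_sub (θ t : ℝ) :
    Real.sigmoid (θ + t) - Real.sigmoid θ =
      Real.sigmoid θ * (Real.exp t - 1) * (1 - Real.sigmoid (θ + t)) := by
  have h1 : 0 < Real.exp θ := Real.exp_pos _
  have h2 : 0 < Real.exp t := Real.exp_pos _
  simp only [Real.sigmoid_def, neg_add, Real.exp_add, Real.exp_neg]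
  field_simp
  ring

theorem one_sub_sigmoid_pos (θ : ℝ) : 0 < 1 - Real.sigmoid θ := by
  linarith [Real.sigmoid_lt_one θ]

/-- One plus the chi-square divergence has the closed form `1 + q (1 - q) e^{-t} (e^t - 1)²` with
`q` the sigmoid of `θ`, and the constant is `(1/4) · 3 · 4`. -/
theorem sigmoid_chiSq_le {θ t : ℝ} (ht : |t| ≤ 1) :
    Real.sigmoid θ ^ 2 / Real.sigmoid (θ + t) + (1 - Real.sigmoid θ) ^ 2 / (1 - Real.sigmoid (θ + t))
      ≤ Real.exp (3 * t ^ 2) := by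
  have h1 : 0 < Real.exp θ := Real.exp_pos _
  have h2 : 0 < Real.exp t := Real.exp_pos _
  have key : Real.sigmoid θ ^ 2 / Real.sigmoid (θ + t) +
      (1 - Real.sigmoid θ) ^ 2 / (1 - Real.sigmoid (θ + t)) =
      1 + Real.sigmoid θ * (1 - Real.sigmoid θ) * Real.exp (-t) * (Real.exp t - 1) ^ 2 := by
    simp only [Real.sigmoid_def, neg_add, Real.exp_add, Real.exp_neg]
    field_simp
    ring
  have hq : Real.sigmoid θ * (1 - Real.sigmoid θ) ≤ 1 / 4 := by
    nlinarith [sq_nonneg (Real.sigmoid θ - 1 / 2)]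
  have he : Real.exp (-t) ≤ 3 := by
    refine (Real.exp_le_exp.2 (neg_le_of_abs_le ht |> fun h => by linarith : -t ≤ 1)).trans ?_
    linarith [Real.exp_one_lt_d9]
  have hs : (Real.exp t - 1) ^ 2 ≤ 4 * t ^ 2 := by
    have := Real.abs_exp_sub_one_le ht
    rw [← sq_abs, ← sq_abs t]
    nlinarith [abs_nonneg (Real.exp t - 1)]
  have h0 := (mul_pos (Real.sigmoid_pos θ) (one_sub_sigmoid_pos θ)).le
  rw [key]
  calc 1 + Real.sigmoid θ * (1 - Real.sigmoid θ) * Real.exp (-t) * (Real.exp t - 1) ^ 2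
      ≤ 1 + 1 / 4 * 3 * (4 * t ^ 2) := by gcongr
    _ = 3 * t ^ 2 + 1 := by ring
    _ ≤ _ := Real.add_one_le_exp _

theorem sq_le_four_mul_exp_sub_one_sq {t : ℝ} (ht : |t| ≤ 1) :
    t ^ 2 ≤ 4 * (Real.exp t - 1) ^ 2 := by
  rw [abs_le] at ht
  rcases le_total 0 t with h | h
  · have := Real.add_one_le_exp t
    nlinarith
  · have h1 := Real.add_one_le_exp (-t)
    have h2 : Real.exp t * Real.exp (-t) = 1 := by rw [← Real.exp_add]; simp
    have h3 : 0 < Real.exp t := Real.exp_pos t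
    have h4 : Real.exp t * (1 - t) ≤ 1 := by nlinarith
    have h5 : -t ≤ 2 * (1 - Real.exp t) := by nlinarith
    nlinarith

theorem sqrt_sub_sqrt_sq_ge {p q : ℝ} (hp : 0 ≤ p) (hq : 0 < q) (hpq : p ≤ 3 * q) :
    (p - q) ^ 2 / (8 * q) ≤ (√p - √q) ^ 2 := by
  have h1 := Real.sq_sqrt hp
  have h2 := Real.sq_sqrt hq.le
  rw [div_le_iff₀ (by positivity)]
  have h3 : (√p + √q) ^ 2 ≤ 8 * q := by nlinarith [sq_nonneg (√p - √q)]
  calc (p - q) ^ 2 = (√p - √q) ^ 2 * (√p + √q) ^ 2 := by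
        rw [← mul_pow]; congr 1; linear_combination -h1 + h2
    _ ≤ _ := by gcongr

/-- The bound `θ ≤ M` keeps the failure probabilities away from zero, so the link probability is
comparable to `e^θ`. A shift `t` moves it by a relative amount of order `t`, and the squared
Hellinger distance is then of order `e^θ t²`. This factor is the origin of `e^{-β}` in the final
rate. -/
theorem sqrt_sigmoid_dist_ge {θ t M : ℝ} (hθ : θ ≤ M) (ht : |t| ≤ 1) :
    Real.exp θ * t ^ 2 / (32 * (1 + Real.exp (M + 1)) ^ 3) ≤
      (√(Real.sigmoid (θ + t)) - √(Real.sigmoid θ)) ^ 2 := by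
  have hq := Real.sigmoid_pos θ
  have h1 := one_sub_sigmoid_pos (θ + t)
  have hd := sigmoid_add_sub θ t
  have ht' := abs_le.1 ht
  have he : Real.exp t ≤ 3 :=
    (Real.exp_le_exp.2 ht'.2).trans (by linarith [Real.exp_one_lt_d9])
  have hp3 : Real.sigmoid (θ + t) ≤ 3 * Real.sigmoid θ := by
    have : Real.sigmoid θ * (Real.exp t - 1) * (1 - Real.sigmoid (θ + t)) ≤
        Real.sigmoid θ * 2 * 1 := by
      refine mul_le_mul ?_ (by linarith [Real.sigmoid_pos (θ + t)]) h1.le (by positivity)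
      exact mul_le_mul_of_nonneg_left (by linarith) hq.le
    linarith
  refine le_trans ?_ (sqrt_sub_sqrt_sq_ge (Real.sigmoid_nonneg _) hq hp3)
  rw [hd]
  set E := Real.exp (M + 1) with hE
  have hE0 : 0 < E := Real.exp_pos _
  have hsig : ∀ x ≤ M + 1, 1 / (1 + E) ≤ 1 - Real.sigmoid x := by
    intro x hx
    rw [← Real.sigmoid_neg, Real.sigmoid_def, neg_neg, one_div]
    exact inv_anti₀ (by positivity) (by linarith [Real.exp_le_exp.2 hx])
  have h2 := hsig (θ + t) (by linarith)
  have h3 : Real.exp θ / (1 + E) ≤ Real.sigmoid θ := by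
    have h := hsig θ (by linarith)
    have h' : Real.sigmoid θ = Real.exp θ * (1 - Real.sigmoid θ) := by
      have h := Real.sigmoid_mul_rexp_neg θ
      rw [Real.sigmoid_neg, Real.exp_neg] at h
      rw [← h]
      field_simp
    rw [h', div_eq_mul_one_div]
    exact mul_le_mul_of_nonneg_left h (Real.exp_pos _).le
  have h4 := sq_le_four_mul_exp_sub_one_sq ht
  calc Real.exp θ * t ^ 2 / (32 * (1 + E) ^ 3)
      = (Real.exp θ / (1 + E)) * (t ^ 2 / 4) * (1 / (1 + E)) ^ 2 / 8 := by field_simp; ring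
    _ ≤ Real.sigmoid θ * (Real.exp t - 1) ^ 2 * (1 - Real.sigmoid (θ + t)) ^ 2 / 8 := by
        have : t ^ 2 / 4 ≤ (Real.exp t - 1) ^ 2 := by linarith
        gcongr
    _ = _ := by field_simp

/-- By monotonicity a shift beyond `±1` separates at least as well as the shift by `±1`. -/
theorem sqrt_sigmoid_dist_ge_min {θ t M : ℝ} (hθ : θ ≤ M) :
    Real.exp θ * min 1 (t ^ 2) / (32 * (1 + Real.exp (M + 1)) ^ 3) ≤
      (√(Real.sigmoid (θ + t)) - √(Real.sigmoid θ)) ^ 2 := by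
  rcases le_total |t| 1 with h | h
  · have h2 : t ^ 2 ≤ 1 := by rw [← sq_abs]; nlinarith [abs_nonneg t]
    rw [min_eq_right h2]
    exact sqrt_sigmoid_dist_ge hθ h
  · have h2 : 1 ≤ t ^ 2 := by rw [← sq_abs]; nlinarith [abs_nonneg t]
    rw [min_eq_left h2]
    rcases le_abs.1 h with h3 | h3
    · have h4 := sqrt_sigmoid_dist_ge (t := 1) hθ (by simp)
      rw [one_pow] at h4
      refine h4.trans ?_
      have h5 := Real.sqrt_le_sqrt (Real.sigmoid_le (by linarith : θ ≤ θ + 1))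
      have h6 := Real.sqrt_le_sqrt (Real.sigmoid_le (by linarith : θ + 1 ≤ θ + t))
      exact pow_le_pow_left₀ (by linarith) (by linarith) 2
    · have h4 := sqrt_sigmoid_dist_ge (t := -1) hθ (by simp)
      rw [neg_one_sq] at h4
      refine h4.trans ?_
      have h5 := Real.sqrt_le_sqrt (Real.sigmoid_le (by linarith : θ + -1 ≤ θ))
      have h6 := Real.sqrt_le_sqrt (Real.sigmoid_le (by linarith : θ + t ≤ θ + -1))
      nlinarith

/-- A Young inequality with a Hellinger remainder. For `α ≤ 1/2`, write the left side as `(√p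
√q)^{2α} q^{1-2α}` and apply the weighted AM-GM inequality; the other case follows by exchanging `p`
and `q`. -/
theorem rpow_mul_rpow_le {α p q : ℝ} (hα : 0 < α) (hα1 : α < 1) (hp : 0 ≤ p) (hq : 0 ≤ q) :
    p ^ α * q ^ (1 - α) ≤ α * p + (1 - α) * q - min α (1 - α) * (√p - √q) ^ 2 := by
  have key : ∀ {a x y : ℝ}, 0 < a → a ≤ 1 / 2 → 0 ≤ x → 0 ≤ y →
      x ^ a * y ^ (1 - a) ≤ a * x + (1 - a) * y - a * (√x - √y) ^ 2 := by
    intro a x y ha ha2 hx hy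
    have h := Real.geom_mean_le_arith_mean2_weighted (w₁ := 2 * a) (w₂ := 1 - 2 * a)
      (p₁ := √x * √y) (p₂ := y) (by linarith) (by linarith) (by positivity) hy (by ring)
    have h1 : (√x * √y) ^ (2 * a) * y ^ (1 - 2 * a) = x ^ a * y ^ (1 - a) := by
      rw [Real.mul_rpow (Real.sqrt_nonneg _) (Real.sqrt_nonneg _), Real.rpow_mul (Real.sqrt_nonneg _),
        Real.rpow_mul (Real.sqrt_nonneg _), Real.rpow_two, Real.rpow_two, Real.sq_sqrt hx,
        Real.sq_sqrt hy, mul_assoc, ← Real.rpow_add' hy (by linarith)]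
      congr 2
      ring
    rw [h1] at h
    nlinarith [Real.sq_sqrt hx, Real.sq_sqrt hy]
  rcases le_total α (1 - α) with h | h
  · rw [min_eq_left h]
    exact key hα (by linarith) hp hq
  · rw [min_eq_right h]
    have := key (a := 1 - α) (by linarith) (by linarith) hq hp
    rw [sub_sub_cancel] at this
    nlinarith

/-- The linear parts of the two Young inequalities add up to `1`; of the two Hellinger remainders
only the one for a link is kept. -/
theorem sigmoid_affinity_le {α θ t M : ℝ} (hα : 0 < α) (hα1 : α < 1) (hθ : θ ≤ M) :
    Real.sigmoid (θ + t) ^ α * Real.sigmoid θ ^ (1 - α) +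
      (1 - Real.sigmoid (θ + t)) ^ α * (1 - Real.sigmoid θ) ^ (1 - α) ≤
      Real.exp (-(min α (1 - α) / (32 * (1 + Real.exp (M + 1)) ^ 3) *
        (Real.exp θ * min 1 (t ^ 2)))) := by
  have h1 := rpow_mul_rpow_le hα hα1 (Real.sigmoid_nonneg (θ + t)) (Real.sigmoid_nonneg θ)
  have h2 := rpow_mul_rpow_le hα hα1 (one_sub_sigmoid_pos (θ + t)).le (one_sub_sigmoid_pos θ).le
  have hm : 0 < min α (1 - α) := lt_min hα (by linarith)
  have h3 := mul_le_mul_of_nonneg_left (sqrt_sigmoid_dist_ge_min (t := t) hθ) hm.le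
  have h4 : 0 ≤ min α (1 - α) * (√(1 - Real.sigmoid (θ + t)) - √(1 - Real.sigmoid θ)) ^ 2 := by
    positivity
  have h5 := Real.add_one_le_exp (-(min α (1 - α) / (32 * (1 + Real.exp (M + 1)) ^ 3) *
        (Real.exp θ * min 1 (t ^ 2))))
  have h6 : min α (1 - α) / (32 * (1 + Real.exp (M + 1)) ^ 3) * (Real.exp θ * min 1 (t ^ 2)) =
      min α (1 - α) * (Real.exp θ * min 1 (t ^ 2) / (32 * (1 + Real.exp (M + 1)) ^ 3)) := by
    ring
  rw [h6] at h5 ⊢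
  linarith

/-! ### Expectations over networks as finite sums -/

/-- Independence of the links: it reduces expectations over networks to one factor per node pair. -/
theorem sum_network_prod {n : ℕ} (f : NodePair n → Bool → ℝ) :
    ∑ Y : Network n, ∏ e, f e (Y e) = ∏ e, (f e true + f e false) := by
  have h := Finset.prod_univ_sum (fun _ : NodePair n => (Finset.univ : Finset Bool)) f
  simp only [Fintype.piFinset_univ, Fintype.sum_bool] at h
  exact h.symm

theorem likelihood_pos {n d : ℕ} (Y : Network n) (X : Mat n d) (β : ℝ) : 0 < likelihood Y X β := by
  refine Finset.prod_pos fun e _ => ?_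
  split_ifs
  · exact Real.sigmoid_pos _
  · exact one_sub_sigmoid_pos _

theorem likelihood_le_one {n d : ℕ} (Y : Network n) (X : Mat n d) (β : ℝ) :
    likelihood Y X β ≤ 1 := by
  refine Finset.prod_le_one (fun e _ => ?_) fun e _ => ?_
  · split_ifs
    · exact Real.sigmoid_nonneg _
    · exact (one_sub_sigmoid_pos _).le
  · split_ifs
    · exact Real.sigmoid_le_one _
    · linarith [Real.sigmoid_pos (linkLogit β X e)]

instance {n d : ℕ} (β : ℝ) (X : Mat n d) : IsProbabilityMeasure (networkLaw β X) := by
  unfold networkLaw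
  infer_instance

open Classical in
theorem networkLaw_real {n d : ℕ} (β : ℝ) (X : Mat n d) (A : Set (Network n)) :
    (networkLaw β X).real A = ∑ Y ∈ Finset.univ.filter (· ∈ A), likelihood Y X β := by
  have h1 : A = ((Finset.univ.filter (· ∈ A) : Finset (Network n)) : Set (Network n)) := by
    ext; simp
  conv_lhs => rw [h1]
  rw [← sum_measureReal_singleton]
  refine Finset.sum_congr rfl fun Y _ => ?_
  rw [networkLaw, ← Set.univ_pi_singleton, pi_real_pi]
  refine Finset.prod_congr rfl fun e _ => ?_
  cases h : Y e <;> simp <;> rfl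

theorem sum_likelihood_sq_div {n d : ℕ} (X X' : Mat n d) (β β' : ℝ)
    (h : ∀ e, |linkLogit β' X' e - linkLogit β X e| ≤ 1) :
    ∑ Y : Network n, likelihood Y X β ^ 2 / likelihood Y X' β' ≤
      Real.exp (3 * ∑ e, (linkLogit β' X' e - linkLogit β X e) ^ 2) := by
  simp only [likelihood, ← Finset.prod_pow, ← Finset.prod_div_distrib]
  rw [sum_network_prod fun e b => (if b then Real.sigmoid (linkLogit β X e) else
    1 - Real.sigmoid (linkLogit β X e)) ^ 2 / (if b then Real.sigmoid (linkLogit β' X' e) else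
    1 - Real.sigmoid (linkLogit β' X' e)), Finset.mul_sum, Real.exp_sum]
  refine Finset.prod_le_prod (fun e _ => ?_) fun e _ => ?_
  · have h1 := Real.sigmoid_pos (linkLogit β' X' e)
    have h2 := one_sub_sigmoid_pos (linkLogit β' X' e)
    simp only [Bool.false_eq_true, if_true, if_false]
    positivity
  · have := sigmoid_chiSq_le (θ := linkLogit β X e) (h e)
    simpa using this

theorem sum_likelihood_affinity {n d : ℕ} (X X' : Mat n d) (β β' : ℝ) {α M : ℝ} (hα : 0 < α)
    (hα1 : α < 1) (h : ∀ e, linkLogit β X e ≤ M) :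
    ∑ Y : Network n, likelihood Y X β ^ (1 - α) * likelihood Y X' β' ^ α ≤
      Real.exp (-(min α (1 - α) / (32 * (1 + Real.exp (M + 1)) ^ 3) * ∑ e,
        Real.exp (linkLogit β X e) * min 1 ((linkLogit β' X' e - linkLogit β X e) ^ 2))) := by
  have hnn : ∀ (Y : Network n) (X : Mat n d) (β : ℝ) (e : NodePair n), 0 ≤
      if Y e then Real.sigmoid (linkLogit β X e) else 1 - Real.sigmoid (linkLogit β X e) := by
    intro Y X β e
    split_ifs
    · exact Real.sigmoid_nonneg _
    · exact (one_sub_sigmoid_pos _).le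
  have h1 : ∀ Y : Network n, likelihood Y X β ^ (1 - α) * likelihood Y X' β' ^ α =
      ∏ e, (if Y e then Real.sigmoid (linkLogit β X e) else
        1 - Real.sigmoid (linkLogit β X e)) ^ (1 - α) *
        (if Y e then Real.sigmoid (linkLogit β' X' e) else
        1 - Real.sigmoid (linkLogit β' X' e)) ^ α := by
    intro Y
    rw [Finset.prod_mul_distrib, Real.finsetProd_rpow _ _ fun e _ => hnn Y X β e,
      Real.finsetProd_rpow _ _ fun e _ => hnn Y X' β' e]
    rfl
  simp only [h1]
  rw [sum_network_prod fun e b => (if b then Real.sigmoid (linkLogit β X e) else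
    1 - Real.sigmoid (linkLogit β X e)) ^ (1 - α) * (if b then Real.sigmoid (linkLogit β' X' e) else
    1 - Real.sigmoid (linkLogit β' X' e)) ^ α, Finset.mul_sum, ← Finset.sum_neg_distrib,
    Real.exp_sum]
  refine Finset.prod_le_prod (fun e _ => ?_) fun e _ => ?_
  · have h1 := Real.sigmoid_pos (linkLogit β' X' e)
    have h2 := one_sub_sigmoid_pos (linkLogit β' X' e)
    have h3 := Real.sigmoid_pos (linkLogit β X e)
    have h4 := one_sub_sigmoid_pos (linkLogit β X e)
    simp only [Bool.false_eq_true, if_true, if_false]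
    positivity
  · have := sigmoid_affinity_le (t := linkLogit β' X' e - linkLogit β X e) hα hα1 (h e)
    rw [add_sub_cancel] at this
    refine le_trans (le_of_eq ?_) this
    simp only [Bool.false_eq_true, if_true, if_false]
    ring

/-! ### Concentration of fractional posteriors -/

/-- The tangent line of the convex function `1 / y` at `s`. It plays the role of Jensen's inequality
in the lower bound for the normalising constant. -/
theorem two_div_sub_le_one_div {s y : ℝ} (hs : 0 < s) (hy : 0 < y) :
    2 / s - y / s ^ 2 ≤ 1 / y := by
  rw [div_sub_div _ _ hs.ne' (by positivity), div_le_div_iff₀ (by positivity) hy]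
  nlinarith [mul_nonneg hs.le (sq_nonneg (s - y))]

/-- With `x = a / b` this is `x / (1 + x) ≤ x ^ α`. It replaces the fractional likelihood by a
convex function of the inverse likelihood ratio `b / a`, whose mean is a chi-square quantity. -/
theorem inv_one_add_div_le_rpow {α a b : ℝ} (hα : 0 < α) (hα1 : α < 1) (ha : 0 < a) (hb : 0 < b) :
    b ^ α * (1 / (1 + b / a)) ≤ a ^ α := by
  have hx : 0 < a / b := by positivity
  have h1 : 1 / (1 + b / a) ≤ (a / b) ^ α := by
    have h2 : 1 / (1 + b / a) = (a / b) / (1 + a / b) := by field_simp; ring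
    rw [h2]
    rcases le_total (a / b) 1 with h | h
    · calc a / b / (1 + a / b) ≤ a / b := div_le_self hx.le (by linarith)
        _ = (a / b) ^ (1 : ℝ) := (Real.rpow_one _).symm
        _ ≤ _ := Real.rpow_le_rpow_of_exponent_ge hx h hα1.le
    · calc a / b / (1 + a / b) ≤ 1 := by rw [div_le_one (by positivity)]; linarith
        _ ≤ _ := Real.one_le_rpow h hα.le
  calc b ^ α * (1 / (1 + b / a)) ≤ b ^ α * (a / b) ^ α := by gcongr
    _ = a ^ α := by rw [← Real.mul_rpow hb.le hx.le]; congr 1; field_simp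

/-- A Markov inequality for finite weighted sums. -/
theorem sum_filter_le_of_markov {ι : Type*} [Fintype ι] {w b : ι → ℝ} {t c : ℝ}
    (P : ι → Prop) [DecidablePred P] (hb : ∀ i, 0 ≤ b i)
    (hP : ∀ i, P i → t * w i ≤ b i) (hsum : ∑ i, b i ≤ c) (ht : 0 < t) :
    ∑ i ∈ Finset.univ.filter P, w i ≤ c / t := by
  rw [le_div_iff₀ ht, mul_comm, Finset.mul_sum]
  refine le_trans ?_ hsum
  exact (Finset.sum_le_sum fun i hi => hP i (Finset.mem_filter.1 hi).2).trans
    (Finset.sum_le_sum_of_subset_of_nonneg (Finset.filter_subset _ _) fun i _ _ => hb i)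

open Classical in
-- Two Markov bounds suffice. Under the law `l`, the integral of `e^H (L / l)^α` has mean at most
-- `1`, by the affinity bound; the integral of `l / L` over `G` has mean at most `e^r μ(G)`, by the
-- chi-square bound. Outside the two bad events the first controls the numerator of a posterior mean
-- and the second bounds the normalising constant below. The conclusion concerns the posterior mean
-- of `H`, as needed for a Bayes estimate, and not only a posterior probability.
theorem fractional_posterior_concentration {Θ ι : Type*} [MeasurableSpace Θ] [Fintype ι]
    (μ : Measure Θ) [IsProbabilityMeasure μ] (L : ι → Θ → ℝ) (hL : ∀ y θ, 0 < L y θ)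
    (hL1 : ∀ y θ, L y θ ≤ 1) (hLm : ∀ y, Measurable (L y)) (l : ι → ℝ) (hl : ∀ y, 0 < l y)
    {α r b : ℝ} (hα : 0 < α) (hα1 : α < 1) (hr : 1 ≤ r) {G : Set Θ} (hG : MeasurableSet G)
    (hGμ : Real.exp (-r) ≤ μ.real G) (hχ : ∀ θ ∈ G, ∑ y, l y ^ 2 / L y θ ≤ Real.exp r)
    {H : Θ → ℝ} (hHm : Measurable H) (hHb : ∀ᵐ θ ∂μ, |H θ| ≤ b)
    (hH : ∀ᵐ θ ∂μ, ∑ y, l y ^ (1 - α) * L y θ ^ α ≤ Real.exp (-H θ)) :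
    ∑ y ∈ Finset.univ.filter
      (fun y => ¬ (0 < ∫ θ, L y θ ^ α ∂μ ∧ ∫ θ, H θ * L y θ ^ α ∂μ ≤ 5 * r * ∫ θ, L y θ ^ α ∂μ)),
      l y ≤ 2 * Real.exp (-r) := by
  have hLα : ∀ y θ, 0 < L y θ ^ α := fun y θ => Real.rpow_pos_of_pos (hL y θ) _
  have hLα1 : ∀ y θ, L y θ ^ α ≤ 1 := fun y θ => Real.rpow_le_one (hL y θ).le (hL1 y θ) hα.le
  have hLαm : ∀ y, Measurable fun θ => L y θ ^ α := fun y => (hLm y).pow_const _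
  have iL : ∀ y, Integrable (fun θ => L y θ ^ α) μ := fun y =>
    Integrable.of_bound (hLαm y).aestronglyMeasurable 1 (ae_of_all _ fun θ => by
      rw [Real.norm_eq_abs, abs_of_pos (hLα y θ)]; exact hLα1 y θ)
  have iH : ∀ y, Integrable (fun θ => H θ * L y θ ^ α) μ := fun y =>
    Integrable.of_bound (hHm.mul (hLαm y)).aestronglyMeasurable b (by
      filter_upwards [hHb] with θ hθ
      rw [Real.norm_eq_abs, abs_mul, abs_of_pos (hLα y θ)]
      nlinarith [abs_nonneg (H θ), hLα y θ, hLα1 y θ])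
  have iE : ∀ y, Integrable (fun θ => Real.exp (H θ) * L y θ ^ α) μ := fun y =>
    Integrable.of_bound (hHm.exp.mul (hLαm y)).aestronglyMeasurable (Real.exp b) (by
      filter_upwards [hHb] with θ hθ
      rw [Real.norm_eq_abs, abs_mul, abs_of_pos (hLα y θ), abs_of_pos (Real.exp_pos _)]
      have := Real.exp_le_exp.2 ((le_abs_self _).trans hθ)
      calc _ ≤ Real.exp b * 1 := 
          mul_le_mul this (hLα1 y θ) (hLα y θ).le (Real.exp_pos _).le
        _ = _ := mul_one _)
  have iG : ∀ y, IntegrableOn (fun θ => l y / L y θ) G μ := fun y =>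
    Measure.integrableOn_of_bounded (M := Real.exp r / l y) (measure_ne_top _ _)
      ((measurable_const.div (hLm y)).aestronglyMeasurable) (by
      rw [ae_restrict_iff' hG]
      refine ae_of_all _ fun θ hθ => ?_
      have h1 : l y ^ 2 / L y θ ≤ Real.exp r := le_trans
        (Finset.single_le_sum (f := fun y => l y ^ 2 / L y θ)
          (fun y _ => by have := hL y θ; positivity) (Finset.mem_univ y)) (hχ θ hθ)
      have := hL y θ
      have := hl y
      rw [Real.norm_eq_abs, abs_of_pos (by positivity), le_div_iff₀ (hl y)]
      refine le_trans (le_of_eq ?_) h1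
      ring)
  set g := μ.real G with hg
  have hg0 : 0 < g := (Real.exp_pos _).trans_le hGμ
  have hB1 : ∑ y ∈ Finset.univ.filter
      (fun y => Real.exp r * l y ^ α < ∫ θ, Real.exp (H θ) * L y θ ^ α ∂μ), l y ≤
      Real.exp (-r) := by
    refine (sum_filter_le_of_markov (t := Real.exp r) (c := 1)
      (b := fun y => l y ^ (1 - α) * ∫ θ, Real.exp (H θ) * L y θ ^ α ∂μ) _
      (fun y => ?_) (fun y hy => ?_) ?_ (Real.exp_pos _)).trans_eq ?_
    · exact mul_nonneg (Real.rpow_nonneg (hl y).le _) (integral_nonneg fun θ =>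
        mul_nonneg (Real.exp_pos _).le (hLα y θ).le)
    · have h1 : l y = l y ^ (1 - α) * l y ^ α := by
        rw [← Real.rpow_add (hl y), sub_add_cancel, Real.rpow_one]
      calc Real.exp r * l y = l y ^ (1 - α) * (Real.exp r * l y ^ α) := by
            nth_rewrite 1 [h1]; ring
        _ ≤ _ := mul_le_mul_of_nonneg_left hy.le (Real.rpow_nonneg (hl y).le _)
    · simp_rw [← integral_const_mul]
      rw [← integral_finsetSum _ fun y _ => (iE y).const_mul _]
      have h1 : ∫ _ : Θ, (1 : ℝ) ∂μ = 1 := by simp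
      refine le_trans ?_ h1.le
      refine integral_mono_ae (integrable_finsetSum _ fun y _ => (iE y).const_mul _)
        (integrable_const _) ?_
      filter_upwards [hH] with θ hθ
      have h2 : ∑ y, l y ^ (1 - α) * (Real.exp (H θ) * L y θ ^ α) =
          Real.exp (H θ) * ∑ y, l y ^ (1 - α) * L y θ ^ α := by
        rw [Finset.mul_sum]; exact Finset.sum_congr rfl fun y _ => by ring
      rw [h2]
      calc _ ≤ Real.exp (H θ) * Real.exp (-H θ) := by gcongr
        _ = 1 := by rw [← Real.exp_add]; simp
    · rw [Real.exp_neg, one_div]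
  have hB2 : ∑ y ∈ Finset.univ.filter
      (fun y => Real.exp (2 * r) * g < ∫ θ in G, l y / L y θ ∂μ), l y ≤
      Real.exp (-r) := by
    refine (sum_filter_le_of_markov (t := Real.exp (2 * r) * g) (c := Real.exp r * g)
      (b := fun y => l y * ∫ θ in G, l y / L y θ ∂μ) _
      (fun y => ?_) (fun y hy => ?_) ?_ (by positivity)).trans_eq ?_
    · exact mul_nonneg (hl y).le (integral_nonneg fun θ => div_nonneg (hl y).le (hL y θ).le)
    · rw [mul_comm]
      exact mul_le_mul_of_nonneg_left hy.le (hl y).le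
    · simp_rw [← integral_const_mul]
      rw [← integral_finsetSum _ fun y _ => (iG y).const_mul _]
      have h1 : ∫ _ in G, Real.exp r ∂μ = Real.exp r * g := by
        simp [hg, mul_comm]
      rw [← h1]
      refine setIntegral_mono_on (integrable_finsetSum _ fun y _ => (iG y).const_mul _)
        (integrable_const _) hG fun θ hθ => ?_
      refine le_trans (le_of_eq ?_) (hχ θ hθ)
      exact Finset.sum_congr rfl fun y _ => by ring
    · rw [mul_div_mul_right _ _ hg0.ne', ← Real.exp_sub]
      congr 1
      ring
  refine le_trans ?_ (add_le_add hB1 hB2 |>.trans_eq (by ring))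
  rw [← Finset.sum_union_inter]
  refine le_trans ?_ (le_add_of_nonneg_right (Finset.sum_nonneg fun y _ => (hl y).le))
  refine Finset.sum_le_sum_of_subset_of_nonneg ?_ fun y _ _ => (hl y).le
  intro y
  simp only [Finset.mem_filter, Finset.mem_univ, true_and, Finset.mem_union]
  contrapose!
  rintro ⟨h1, h2⟩
  -- The point of tangency: on the good event, `s` bounds the average of `1 + l / L` over `G`.
  set s := 1 + Real.exp (2 * r) with hs
  have hs0 : 0 < s := by positivity
  have hlow : l y ^ α * (g / s) ≤ ∫ θ, L y θ ^ α ∂μ := by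
    have hly : 0 < l y ^ α := Real.rpow_pos_of_pos (hl y) _
    calc l y ^ α * (g / s) = l y ^ α * ((2 / s - 1 / s ^ 2) * g - Real.exp (2 * r) * g / s ^ 2) := by
          congr 1
          have : Real.exp (2 * r) = s - 1 := by rw [hs]; ring
          rw [this]
          field_simp
          ring
      _ ≤ l y ^ α * ((2 / s - 1 / s ^ 2) * g - (∫ θ in G, l y / L y θ ∂μ) / s ^ 2) := by
          gcongr
      _ = ∫ θ in G, l y ^ α * ((2 / s - 1 / s ^ 2) - (l y / L y θ) / s ^ 2) ∂μ := by
          rw [integral_const_mul, integral_sub (integrable_const _) ((iG y).div_const _),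
            integral_div]
          simp [hg, mul_comm]
      _ ≤ ∫ θ in G, L y θ ^ α ∂μ := by
          refine integral_mono (((integrable_const _).sub ((iG y).div_const _)).const_mul _)
            (iL y).integrableOn fun θ => ?_
          refine le_trans ?_ (inv_one_add_div_le_rpow hα hα1 (hL y θ) (hl y))
          have h0 : 0 < 1 + l y / L y θ := by
            have := hL y θ
            have := hl y
            positivity
          refine mul_le_mul_of_nonneg_left ?_ hly.le
          refine le_trans (le_of_eq ?_) (two_div_sub_le_one_div hs0 h0)
          ring
      _ ≤ _ := setIntegral_le_integral (iL y) (ae_of_all _ fun θ => (hLα y θ).le)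
  have hpos : 0 < ∫ θ, L y θ ^ α ∂μ := by
    refine lt_of_lt_of_le ?_ hlow
    have := Real.rpow_pos_of_pos (hl y) α
    positivity
  refine ⟨hpos, ?_⟩
  -- The exponent `5 r` collects `r` from the numerator, `3 r` from `s ≤ e^{3r}` and `r` from `1 / g
  -- ≤ e^r`.
  have hup : Real.exp (-(5 * r)) * ∫ θ, Real.exp (H θ) * L y θ ^ α ∂μ ≤ ∫ θ, L y θ ^ α ∂μ := by
    refine le_trans ?_ hlow
    have hly : 0 < l y ^ α := Real.rpow_pos_of_pos (hl y) _
    have hE1 : 2 ≤ Real.exp r := by linarith [Real.add_one_le_exp r]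
    have hg' : 1 ≤ Real.exp r * g := by
      calc (1 : ℝ) = Real.exp r * Real.exp (-r) := by rw [← Real.exp_add]; simp
        _ ≤ _ := by gcongr
    have e2 : Real.exp (2 * r) = Real.exp r ^ 2 := by rw [← Real.exp_nat_mul]; norm_num
    have e5 : Real.exp (-(5 * r)) = (Real.exp r ^ 5)⁻¹ := by
      rw [Real.exp_neg, ← Real.exp_nat_mul]; norm_num
    rw [e2] at hs
    set E := Real.exp r
    rw [e5, inv_mul_le_iff₀ (by positivity)]
    refine h1.trans ?_
    have hsE : s ≤ E ^ 3 := by rw [hs]; nlinarith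
    have : E * l y ^ α * s ≤ E ^ 5 * (l y ^ α * g) := by
      calc E * l y ^ α * s ≤ E * l y ^ α * E ^ 3 * (E * g) := by
            refine le_trans (mul_le_mul_of_nonneg_left hsE (by positivity)) ?_
            exact le_mul_of_one_le_right (by positivity) hg'
        _ = _ := by ring
    rw [← mul_div_assoc, ← mul_div_assoc, le_div_iff₀ hs0]
    exact this
  -- An exponential moment controls the mean through `H ≤ 5r - 1 + e^{H - 5r}`.
  calc ∫ θ, H θ * L y θ ^ α ∂μ ≤ ∫ θ, ((5 * r - 1) * L y θ ^ α +
        Real.exp (-(5 * r)) * (Real.exp (H θ) * L y θ ^ α)) ∂μ := by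
        refine integral_mono (iH y) (((iL y).const_mul _).add ((iE y).const_mul _)) fun θ => ?_
        have h3 := Real.add_one_le_exp (H θ - 5 * r)
        have h4 : Real.exp (-(5 * r)) * (Real.exp (H θ) * L y θ ^ α) =
            Real.exp (H θ - 5 * r) * L y θ ^ α := by
          rw [← mul_assoc, ← Real.exp_add]; congr 2; ring
        show _ ≤ (5 * r - 1) * L y θ ^ α + Real.exp (-(5 * r)) * (Real.exp (H θ) * L y θ ^ α)
        rw [h4, ← add_mul]
        exact mul_le_mul_of_nonneg_right (by linarith) (hLα y θ).le
    _ = (5 * r - 1) * ∫ θ, L y θ ^ α ∂μ +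
        Real.exp (-(5 * r)) * ∫ θ, Real.exp (H θ) * L y θ ^ α ∂μ := by
        rw [integral_add ((iL y).const_mul _) ((iE y).const_mul _), integral_const_mul,
          integral_const_mul]
    _ ≤ _ := by linarith

/-! ### Sums over node pairs -/

theorem sum_nodePair_le {n : ℕ} {f : Fin n × Fin n → ℝ} (hf : ∀ q, 0 ≤ f q) :
    ∑ e : NodePair n, f e.1 ≤ ∑ i, ∑ j, f (i, j) := by
  rw [← Fintype.sum_prod_type, ← Finset.sum_subtype (Finset.univ.filter fun q : Fin n × Fin n => q.1 ≤ q.2)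
    (fun q => by simp) f]
  exact Finset.sum_le_sum_of_subset_of_nonneg (Finset.filter_subset _ _) fun q _ _ => hf q

theorem sum_sum_le_two_mul_nodePair {n : ℕ} {f : Fin n × Fin n → ℝ} (hf : ∀ q, 0 ≤ f q)
    (hsymm : ∀ q, f q.swap = f q) :
    ∑ i, ∑ j, f (i, j) ≤ 2 * ∑ e : NodePair n, f e.1 := by
  rw [← Fintype.sum_prod_type, ← Finset.sum_subtype (Finset.univ.filter fun q : Fin n × Fin n => q.1 ≤ q.2)
    (fun q => by simp) f, two_mul]
  have h1 : ∑ q ∈ Finset.univ.filter (fun q : Fin n × Fin n => q.1 ≤ q.2), f q =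
      ∑ q ∈ Finset.univ.filter (fun q : Fin n × Fin n => q.2 ≤ q.1), f q := by
    refine Finset.sum_bij' (fun q _ => q.swap) (fun q _ => q.swap) ?_ ?_ ?_ ?_ ?_ <;> simp [hsymm]
  conv_rhs => arg 2; rw [h1]
  rw [← Finset.sum_union_inter]
  refine le_trans ?_ (le_add_of_nonneg_right (Finset.sum_nonneg fun q _ => hf q))
  refine le_of_eq (Finset.sum_congr ?_ fun _ _ => rfl)
  ext q
  simpa using le_total q.1 q.2

/-! ### Inner products of bounded positions -/

/-- The matrix of differences between the inner products of two position matrices. -/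
noncomputable def gramDiff {n d : ℕ} (X M : Mat n d) (i j : Fin n) : ℝ :=
  (∑ k, X i k * X j k) - ∑ k, M i k * M j k

theorem innerProductLoss_eq {n d : ℕ} (X M : Mat n d) :
    innerProductLoss X M = (1 / (n : ℝ) ^ 2) * ∑ i, ∑ j, gramDiff X M i j ^ 2 := rfl

theorem gramDiff_symm {n d : ℕ} (X M : Mat n d) (i j : Fin n) :
    gramDiff X M i j = gramDiff X M j i := by
  simp only [gramDiff, mul_comm]

theorem linkLogit_sub {n d : ℕ} (β β' : ℝ) (X X' : Mat n d) (e : NodePair n) :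
    linkLogit β X e - linkLogit β' X' e = (β - β') + gramDiff X X' e.1.1 e.1.2 := by
  simp only [linkLogit, gramDiff]
  ring

theorem abs_inner_le {n d : ℕ} {X : Mat n d} {c : ℝ} (h : ∀ i k, |X i k| ≤ c) (i j : Fin n) :
    |∑ k, X i k * X j k| ≤ d * c ^ 2 := by
  refine (Finset.abs_sum_le_sum_abs _ _).trans ?_
  calc ∑ k, |X i k * X j k| ≤ ∑ _k : Fin d, c ^ 2 := by
        refine Finset.sum_le_sum fun k _ => ?_
        rw [abs_mul, sq]
        exact mul_le_mul (h i k) (h j k) (abs_nonneg _) ((abs_nonneg _).trans (h i k))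
    _ = _ := by simp

theorem abs_gramDiff_le {n d : ℕ} {X M : Mat n d} {c η : ℝ} (hX : ∀ i k, |X i k| ≤ c)
    (hM : ∀ i k, |M i k| ≤ c) (h : ∀ i k, |X i k - M i k| ≤ η) (i j : Fin n) :
    |gramDiff X M i j| ≤ d * (2 * c * η) := by
  have h1 : gramDiff X M i j = ∑ k, ((X i k - M i k) * X j k + M i k * (X j k - M j k)) := by
    rw [gramDiff, ← Finset.sum_sub_distrib]
    exact Finset.sum_congr rfl fun k _ => by ring
  rw [h1]
  refine (Finset.abs_sum_le_sum_abs _ _).trans ?_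
  calc _ ≤ ∑ _k : Fin d, 2 * c * η := by
        refine Finset.sum_le_sum fun k _ => (abs_add_le _ _).trans ?_
        rw [abs_mul, abs_mul]
        have h2 := mul_le_mul (h i k) (hX j k) (abs_nonneg _) ((abs_nonneg _).trans (h i k))
        have h3 := mul_le_mul (hM i k) (h j k) (abs_nonneg _) ((abs_nonneg _).trans (hM i k))
        linarith
    _ = _ := by simp

/-- The entries of a Gram matrix sum to the squared norm of the sum of the rows, which vanishes for
the centred matrix `M`. -/
theorem sum_gramDiff {n d : ℕ} (X M : Mat n d) (hM : ∀ k, ∑ i, M i k = 0) :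
    ∑ i, ∑ j, gramDiff X M i j = ∑ k, (∑ i, X i k) ^ 2 := by
  have h : ∀ Y : Mat n d, ∑ i, ∑ j, ∑ k, Y i k * Y j k = ∑ k, (∑ i, Y i k) ^ 2 := by
    intro Y
    simp_rw [sq, Finset.sum_mul_sum]
    rw [Finset.sum_comm' (t' := Finset.univ) (s' := fun _ => Finset.univ) (by simp)]
    conv_lhs => enter [2, j]; rw [Finset.sum_comm]
    rw [Finset.sum_comm]
    refine Finset.sum_congr rfl fun k _ => ?_
    rw [Finset.sum_comm]
  simp only [gramDiff, Finset.sum_sub_distrib]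
  rw [h, h]
  simp [hM]

/-- The intercept error `b` is eliminated. If `|b| ≥ 2R + 1`, no inner-product error can cancel it
and every truncated term equals `1`. Otherwise truncation costs at most the factor `(4R + 1)²`, and
in the expanded square the cross term is `2b` times the total sum of the errors, which the
column-sum constraint bounds. -/
theorem sum_min_sq_ge {n d : ℕ} (hn : 0 < n) {X M : Mat n d} {c₅ c₆ R b : ℝ}
    (hX : X ∈ boundedCentred n d c₅ c₆) (hM : ∀ i k, |M i k| ≤ c₅) (hM0 : ∀ k, ∑ i, M i k = 0)
    (hR : d * c₅ ^ 2 ≤ R) :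
    (∑ i, ∑ j, gramDiff X M i j ^ 2 - (d * c₆ ^ 2) ^ 2) / (4 * R + 1) ^ 2 ≤
      ∑ i, ∑ j, min 1 ((b + gramDiff X M i j) ^ 2) := by
  have hR0 : 0 ≤ R := le_trans (by positivity) hR
  have hn1 : (1 : ℝ) ≤ n := by exact_mod_cast hn
  have hΔ : ∀ i j, |gramDiff X M i j| ≤ 2 * R := fun i j => by
    refine (abs_sub _ _).trans ?_
    linarith [abs_inner_le hX.1 i j, abs_inner_le hM i j]
  rw [div_le_iff₀ (by positivity)]
  rcases le_total (2 * R + 1) |b| with hb | hb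
  · have h1 : ∀ i j, gramDiff X M i j ^ 2 ≤
        min 1 ((b + gramDiff X M i j) ^ 2) * (4 * R + 1) ^ 2 := by
      intro i j
      have h2 : 1 ≤ |b + gramDiff X M i j| := by
        have := abs_sub_abs_le_abs_sub b (-gramDiff X M i j)
        rw [abs_neg, sub_neg_eq_add] at this
        linarith [hΔ i j]
      have h3 : (1 : ℝ) ≤ (b + gramDiff X M i j) ^ 2 := by
        rw [← sq_abs]; nlinarith
      rw [min_eq_left h3, one_mul, ← sq_abs]
      exact pow_le_pow_left₀ (abs_nonneg _) (by linarith [hΔ i j]) 2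
    simp_rw [Finset.sum_mul]
    have := Finset.sum_le_sum fun i (_ : i ∈ Finset.univ) =>
      Finset.sum_le_sum fun j (_ : j ∈ Finset.univ) => h1 i j
    linarith [sq_nonneg (d * c₆ ^ 2)]
  · have h1 : ∀ i j, (b + gramDiff X M i j) ^ 2 ≤
        min 1 ((b + gramDiff X M i j) ^ 2) * (4 * R + 1) ^ 2 := by
      intro i j
      have h2 : |b + gramDiff X M i j| ≤ 4 * R + 1 :=
        (abs_add_le _ _).trans (by linarith [hΔ i j])
      have h3 : (b + gramDiff X M i j) ^ 2 ≤ (4 * R + 1) ^ 2 := by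
        rw [← sq_abs]; exact pow_le_pow_left₀ (abs_nonneg _) h2 2
      have h4 : (1 : ℝ) ≤ (4 * R + 1) ^ 2 := by nlinarith
      rcases min_choice 1 ((b + gramDiff X M i j) ^ 2) with h | h <;> rw [h]
      · linarith
      · nlinarith [sq_nonneg (b + gramDiff X M i j)]
    simp_rw [Finset.sum_mul]
    refine le_trans ?_ (Finset.sum_le_sum fun i (_ : i ∈ Finset.univ) =>
      Finset.sum_le_sum fun j (_ : j ∈ Finset.univ) => h1 i j)
    have h5 : ∑ i, ∑ j, (b + gramDiff X M i j) ^ 2 = (n : ℝ) ^ 2 * b ^ 2 +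
        2 * b * ∑ i, ∑ j, gramDiff X M i j + ∑ i, ∑ j, gramDiff X M i j ^ 2 := by
      simp only [add_sq, Finset.sum_add_distrib, ← Finset.mul_sum]
      simp
      ring
    set S := ∑ i, ∑ j, gramDiff X M i j with hS
    have hS1 : S ^ 2 ≤ (d * c₆ ^ 2) ^ 2 := by
      rw [hS, sum_gramDiff X M hM0]
      refine pow_le_pow_left₀ (Finset.sum_nonneg fun k _ => sq_nonneg _) ?_ 2
      calc ∑ k, (∑ i, X i k) ^ 2 ≤ ∑ _k : Fin d, c₆ ^ 2 := by
            refine Finset.sum_le_sum fun k _ => ?_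
            rw [← sq_abs]
            exact pow_le_pow_left₀ (abs_nonneg _) (hX.2 k) 2
        _ = _ := by simp
    rw [h5]
    have hn2 : (1 : ℝ) ≤ (n : ℝ) ^ 2 := one_le_pow₀ hn1
    -- Here `n² b² + 2bS ≥ (b + S)² - S² ≥ -S²`.
    nlinarith [sq_nonneg (b + S), sq_nonneg b]

/-! ### The posterior expected loss -/

@[fun_prop]
theorem measurable_likelihood {n d : ℕ} (Y : Network n) :
    Measurable fun θ : Mat n d × ℝ => likelihood Y θ.1 θ.2 := by
  refine Continuous.measurable ?_
  unfold likelihood linkLogit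
  refine continuous_finsetProd _ fun e _ => ?_
  split_ifs <;> fun_prop

@[fun_prop]
theorem measurable_innerProductLoss {n d : ℕ} (M : Mat n d) :
    Measurable fun θ : Mat n d × ℝ => innerProductLoss θ.1 M := by
  unfold innerProductLoss
  fun_prop

theorem integral_fractionalPosterior {n d : ℕ} (α : ℝ) (μ : Measure (Mat n d × ℝ))
    [IsProbabilityMeasure μ] (hα : 0 < α) (Y : Network n) (f : Mat n d × ℝ → ℝ) :
    ∫ θ, f θ ∂(fractionalPosterior α μ Y) =
      (∫ θ, f θ * likelihood Y θ.1 θ.2 ^ α ∂μ) / ∫ θ, likelihood Y θ.1 θ.2 ^ α ∂μ := by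
  have hm : Measurable fun θ : Mat n d × ℝ => likelihood Y θ.1 θ.2 ^ α :=
    (measurable_likelihood Y).pow_const _
  have h0 : ∀ θ : Mat n d × ℝ, 0 ≤ likelihood Y θ.1 θ.2 ^ α := fun θ =>
    Real.rpow_nonneg (likelihood_pos _ _ _).le _
  have hi : Integrable (fun θ : Mat n d × ℝ => likelihood Y θ.1 θ.2 ^ α) μ :=
    Integrable.of_bound hm.aestronglyMeasurable 1 (ae_of_all _ fun θ => by
      rw [Real.norm_eq_abs, abs_of_nonneg (h0 θ)]
      exact Real.rpow_le_one (likelihood_pos _ _ _).le (likelihood_le_one _ _ _) hα.le)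
  rw [fractionalPosterior, integral_smul_measure, fractionalWeight,
    withDensity_apply _ MeasurableSet.univ, Measure.restrict_univ,
    ← ofReal_integral_eq_lintegral_ofReal hi (ae_of_all _ h0),
    integral_withDensity_eq_integral_toReal_smul hm.ennreal_ofReal
      (ae_of_all _ fun θ => ENNReal.ofReal_lt_top), ENNReal.toReal_inv,
    ENNReal.toReal_ofReal (integral_nonneg h0), smul_eq_mul, div_eq_inv_mul]
  congr 2
  ext θ
  rw [ENNReal.toReal_ofReal (h0 θ), smul_eq_mul, mul_comm]

theorem innerProductLoss_triangle {n d : ℕ} (X M M' : Mat n d) :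
    innerProductLoss M M' ≤ 2 * innerProductLoss X M + 2 * innerProductLoss X M' := by
  simp only [innerProductLoss_eq]
  have : ∑ i, ∑ j, gramDiff M M' i j ^ 2 ≤ ∑ i, ∑ j, (2 * gramDiff X M i j ^ 2 +
      2 * gramDiff X M' i j ^ 2) := by
    refine Finset.sum_le_sum fun i _ => Finset.sum_le_sum fun j _ => ?_
    have : gramDiff M M' i j = gramDiff X M' i j - gramDiff X M i j := by
      simp only [gramDiff]; ring
    rw [this]
    nlinarith [sq_nonneg (gramDiff X M' i j + gramDiff X M i j)]
  simp only [Finset.sum_add_distrib, ← Finset.mul_sum] at this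
  have h := mul_le_mul_of_nonneg_left this (by positivity : (0 : ℝ) ≤ 1 / (n : ℝ) ^ 2)
  linarith

theorem innerProductLoss_nonneg {n d : ℕ} (X M : Mat n d) : 0 ≤ innerProductLoss X M := by
  unfold innerProductLoss
  positivity

theorem innerProductLoss_le {n d : ℕ} {X : Mat n d} (M : Mat n d) {c : ℝ}
    (h : ∀ i k, |X i k| ≤ c) :
    innerProductLoss X M ≤
      (1 / (n : ℝ) ^ 2) * ∑ i, ∑ j, (d * c ^ 2 + |∑ k, M i k * M j k|) ^ 2 := by
  unfold innerProductLoss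
  refine mul_le_mul_of_nonneg_left (Finset.sum_le_sum fun i _ => Finset.sum_le_sum fun j _ => ?_)
    (by positivity)
  rw [← sq_abs]
  refine pow_le_pow_left₀ (abs_nonneg _) ((abs_sub _ _).trans ?_) 2
  gcongr
  exact abs_inner_le h i j

/-- The factor of the exponent by which the likelihood affinity separates positions. -/
noncomputable def affinityRate (α R cβ : ℝ) : ℝ :=
  min α (1 - α) / (32 * (1 + Real.exp (cβ + R + 1)) ^ 3) *
    (Real.exp (-R) / (2 * (4 * R + 1) ^ 2))

theorem affinityRate_pos {α R : ℝ} (cβ : ℝ) (hα : 0 < α) (hα1 : α < 1) (hR : 0 ≤ R) :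
    0 < affinityRate α R cβ := by
  have : 0 < min α (1 - α) := lt_min hα (by linarith)
  unfold affinityRate
  positivity

/-- In the product of the one-pair bounds each true log-odds is at least `β₀ - R`, which extracts
`e^{β₀}`; passing from pairs `i ≤ j` to ordered pairs costs a factor `2`. -/
theorem sum_likelihood_affinity_le {n d : ℕ} (hn : 0 < n) {X M : Mat n d} {c₅ c₆ R α β β₀ cβ : ℝ}
    (hα : 0 < α) (hα1 : α < 1) (hX : X ∈ boundedCentred n d c₅ c₆) (hM : ∀ i k, |M i k| ≤ c₅)
    (hM0 : ∀ k, ∑ i, M i k = 0) (hR : d * c₅ ^ 2 ≤ R) (hβ : β₀ ≤ cβ) :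
    ∑ Y : Network n, likelihood Y M β₀ ^ (1 - α) * likelihood Y X β ^ α ≤
      Real.exp (-(affinityRate α R cβ * Real.exp β₀ *
        ((n : ℝ) ^ 2 * innerProductLoss X M - (d * c₆ ^ 2) ^ 2))) := by
  have hlog : ∀ e, |linkLogit β₀ M e - β₀| ≤ R := fun e => by
    rw [linkLogit, add_sub_cancel_left]
    exact (abs_inner_le hM _ _).trans hR
  have hm : 0 < min α (1 - α) := lt_min hα (by linarith)
  refine (sum_likelihood_affinity M X β₀ β hα hα1 (M := cβ + R)
    fun e => by linarith [(abs_le.1 (hlog e)).2]).trans (Real.exp_le_exp.2 (neg_le_neg ?_))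
  have hn0 : (n : ℝ) ≠ 0 := by exact_mod_cast hn.ne'
  have h1 : (n : ℝ) ^ 2 * innerProductLoss X M = ∑ i, ∑ j, gramDiff X M i j ^ 2 := by
    rw [innerProductLoss_eq]
    field_simp
  have h2 := sum_min_sq_ge hn (b := β - β₀) hX hM hM0 hR
  have h3 := sum_sum_le_two_mul_nodePair
    (f := fun q => min 1 ((β - β₀ + gramDiff X M q.1 q.2) ^ 2)) (fun q => by positivity)
    (fun q => by simp only [Prod.fst_swap, Prod.snd_swap, gramDiff_symm X M q.2])
  have h4 : Real.exp (β₀ - R) * ∑ e : NodePair n,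
      min 1 ((β - β₀ + gramDiff X M e.1.1 e.1.2) ^ 2) ≤
      ∑ e, Real.exp (linkLogit β₀ M e) * min 1 ((linkLogit β X e - linkLogit β₀ M e) ^ 2) := by
    rw [Finset.mul_sum]
    refine Finset.sum_le_sum fun e _ => ?_
    rw [linkLogit_sub]
    refine mul_le_mul_of_nonneg_right (Real.exp_le_exp.2 ?_) (by positivity)
    linarith [(abs_le.1 (hlog e)).1]
  rw [h1, affinityRate]
  calc _ = min α (1 - α) / (32 * (1 + Real.exp (cβ + R + 1)) ^ 3) * (Real.exp (β₀ - R) *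
        ((∑ i, ∑ j, gramDiff X M i j ^ 2 - (d * c₆ ^ 2) ^ 2) / (4 * R + 1) ^ 2 / 2)) := by
        rw [sub_eq_add_neg β₀ R, Real.exp_add β₀]
        field_simp
    _ ≤ _ := by
        refine mul_le_mul_of_nonneg_left (le_trans ?_ h4) (by positivity)
        refine mul_le_mul_of_nonneg_left ?_ (Real.exp_pos _).le
        linarith

open Classical in
-- On the good event the posterior mean of the loss at the truth `M` is small. A Bayes estimate `U`
-- has no larger expected loss than `M`, and the triangle inequality through a posterior draw bounds
-- the loss between `U` and `M` by four times the expected loss at `M`.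
theorem bayes_loss_concentration {n d : ℕ} (hn : 0 < n) {M : Mat n d} {c₅ c₆ R α β₀ cβ r : ℝ}
    (hα : 0 < α) (hα1 : α < 1) (hM : ∀ i k, |M i k| ≤ c₅)
    (hM0 : ∀ k, ∑ i, M i k = 0) (hR : d * c₅ ^ 2 ≤ R) (hβ : β₀ ≤ cβ) (hr : 1 ≤ r)
    (μ : Measure (Mat n d × ℝ)) [IsProbabilityMeasure μ]
    (hμ : ∀ᵐ θ ∂μ, θ.1 ∈ boundedCentred n d c₅ c₆) {G : Set (Mat n d × ℝ)}
    (hG : MeasurableSet G) (hGμ : Real.exp (-r) ≤ μ.real G)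
    (hGt : ∀ θ ∈ G, (∀ e, |linkLogit θ.2 θ.1 e - linkLogit β₀ M e| ≤ 1) ∧
      3 * ∑ e, (linkLogit θ.2 θ.1 e - linkLogit β₀ M e) ^ 2 ≤ r) :
    1 - 2 * Real.exp (-r) ≤ (networkLaw β₀ M).real {Y | ∀ U : Mat n d,
      IsBayesEstimate (fractionalPosterior α μ Y) U →
      affinityRate α R cβ * Real.exp β₀ * ((n : ℝ) ^ 2 * innerProductLoss U M) ≤
        4 * (5 * r + affinityRate α R cβ * Real.exp β₀ * (d * c₆ ^ 2) ^ 2)} := by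
  have hR0 : 0 ≤ R := le_trans (by positivity) hR
  set κ := affinityRate α R cβ * Real.exp β₀ with hκ
  have hκ0 : 0 < κ := mul_pos (affinityRate_pos cβ hα hα1 hR0) (Real.exp_pos _)
  have hn0 : (0 : ℝ) < n := by exact_mod_cast hn
  set S := ((d : ℝ) * c₆ ^ 2) ^ 2
  have hlossi : ∀ U : Mat n d, ∀ Y : Network n,
      Integrable (fun θ : Mat n d × ℝ => innerProductLoss θ.1 U * likelihood Y θ.1 θ.2 ^ α) μ := by
    intro U Y
    refine Integrable.of_bound ((measurable_innerProductLoss U).mul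
      ((measurable_likelihood Y).pow_const _)).aestronglyMeasurable
      ((1 / (n : ℝ) ^ 2) * ∑ i, ∑ j, (d * c₅ ^ 2 + |∑ k, U i k * U j k|) ^ 2) ?_
    filter_upwards [hμ] with θ hθ
    have h1 := innerProductLoss_le U hθ.1
    have h2 := Real.rpow_le_one (likelihood_pos Y θ.1 θ.2).le (likelihood_le_one _ _ _) hα.le
    have h3 := Real.rpow_nonneg (likelihood_pos Y θ.1 θ.2).le α
    have h4 := innerProductLoss_nonneg θ.1 U
    rw [Real.norm_eq_abs, abs_of_nonneg (mul_nonneg h4 h3)]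
    nlinarith
  have hLi : ∀ Y : Network n, Integrable (fun θ : Mat n d × ℝ => likelihood Y θ.1 θ.2 ^ α) μ := by
    intro Y
    refine Integrable.of_bound ((measurable_likelihood Y).pow_const _).aestronglyMeasurable 1
      (ae_of_all _ fun θ => ?_)
    rw [Real.norm_eq_abs, abs_of_nonneg (Real.rpow_nonneg (likelihood_pos Y θ.1 θ.2).le α)]
    exact Real.rpow_le_one (likelihood_pos Y θ.1 θ.2).le (likelihood_le_one _ _ _) hα.le
  have key := fractional_posterior_concentration μ
    (fun (Y : Network n) (θ : Mat n d × ℝ) => likelihood Y θ.1 θ.2)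
    (fun Y θ => likelihood_pos _ _ _) (fun Y θ => likelihood_le_one _ _ _)
    (fun Y => measurable_likelihood Y) (fun Y => likelihood Y M β₀) (fun Y => likelihood_pos _ _ _)
    hα hα1 hr hG hGμ
    (fun θ hθ => (sum_likelihood_sq_div M θ.1 β₀ θ.2 (hGt θ hθ).1).trans
      (Real.exp_le_exp.2 (hGt θ hθ).2))
    (H := fun θ => κ * ((n : ℝ) ^ 2 * innerProductLoss θ.1 M - S))
    (b := κ * ((n : ℝ) ^ 2 *
      ((1 / (n : ℝ) ^ 2) * ∑ i, ∑ j, (d * c₅ ^ 2 + |∑ k, M i k * M j k|) ^ 2) + S))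
    (by fun_prop) (by
      filter_upwards [hμ] with θ hθ
      have h1 := innerProductLoss_le M hθ.1
      have h4 := innerProductLoss_nonneg θ.1 M
      have hS : 0 ≤ S := by positivity
      rw [abs_mul, abs_of_pos hκ0]
      refine mul_le_mul_of_nonneg_left ((abs_sub _ _).trans ?_) hκ0.le
      rw [abs_of_nonneg hS, abs_of_nonneg (by positivity)]
      gcongr)
    (by
      filter_upwards [hμ] with θ hθ
      exact sum_likelihood_affinity_le hn hα hα1 hθ hM hM0 hR hβ)
  set P : Network n → Prop := fun Y => 0 < ∫ θ, likelihood Y θ.1 θ.2 ^ α ∂μ ∧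
    ∫ θ, κ * ((n : ℝ) ^ 2 * innerProductLoss θ.1 M - S) * likelihood Y θ.1 θ.2 ^ α ∂μ ≤
      5 * r * ∫ θ, likelihood Y θ.1 θ.2 ^ α ∂μ with hP
  have hmeasP : (networkLaw β₀ M).real {Y | P Y}ᶜ ≤ 2 * Real.exp (-r) := by
    rw [networkLaw_real]
    refine le_trans (le_of_eq ?_) key
    exact Finset.sum_congr (by ext; simp [hP]) fun _ _ => rfl
  rw [probReal_compl_eq_one_sub (Set.toFinite _).measurableSet] at hmeasP
  have hsub : {Y | P Y} ⊆ {Y | ∀ U : Mat n d,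
      IsBayesEstimate (fractionalPosterior α μ Y) U →
      κ * ((n : ℝ) ^ 2 * innerProductLoss U M) ≤ 4 * (5 * r + κ * S)} := by
    rintro Y ⟨hpos, hle⟩ U hU
    have h1 := hU M
    rw [integral_fractionalPosterior α μ hα, integral_fractionalPosterior α μ hα,
      div_le_div_iff_of_pos_right hpos] at h1
    set I := ∫ θ, likelihood Y θ.1 θ.2 ^ α ∂μ with hI
    set J := ∫ θ, innerProductLoss θ.1 M * likelihood Y θ.1 θ.2 ^ α ∂μ with hJ
    have h2 : innerProductLoss U M * I ≤ 4 * J := by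
      calc innerProductLoss U M * I =
          ∫ θ, innerProductLoss U M * likelihood Y θ.1 θ.2 ^ α ∂μ := by
            rw [integral_const_mul]
        _ ≤ ∫ θ, (2 * (innerProductLoss θ.1 U * likelihood Y θ.1 θ.2 ^ α) +
            2 * (innerProductLoss θ.1 M * likelihood Y θ.1 θ.2 ^ α)) ∂μ := by
            refine integral_mono ((hLi Y).const_mul _)
              (((hlossi U Y).const_mul _).add ((hlossi M Y).const_mul _)) fun θ => ?_
            have h3 := Real.rpow_nonneg (likelihood_pos Y θ.1 θ.2).le α
            have := mul_le_mul_of_nonneg_right (innerProductLoss_triangle θ.1 U M) h3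
            refine this.trans_eq ?_
            ring
        _ = 2 * (∫ θ, innerProductLoss θ.1 U * likelihood Y θ.1 θ.2 ^ α ∂μ) + 2 * J := by
            rw [integral_add ((hlossi U Y).const_mul _) ((hlossi M Y).const_mul _),
              integral_const_mul, integral_const_mul]
        _ ≤ _ := by linarith
    have h4 : ∫ θ, κ * ((n : ℝ) ^ 2 * innerProductLoss θ.1 M - S) * likelihood Y θ.1 θ.2 ^ α ∂μ =
        κ * (n : ℝ) ^ 2 * J - κ * S * I := by
      rw [hJ, hI, ← integral_const_mul, ← integral_const_mul,
        ← integral_sub ((hlossi M Y).const_mul _) ((hLi Y).const_mul _)]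
      congr 1
      ext θ
      ring
    rw [h4] at hle
    refine le_of_mul_le_mul_right ?_ hpos
    calc κ * ((n : ℝ) ^ 2 * innerProductLoss U M) * I
        = κ * (n : ℝ) ^ 2 * (innerProductLoss U M * I) := by ring
      _ ≤ κ * (n : ℝ) ^ 2 * (4 * J) := by gcongr
      _ ≤ 4 * (5 * r + κ * S) * I := by linarith
  have := measureReal_mono (μ := networkLaw β₀ M) hsub
  linarith

/-! ### Prior mass around the truth -/

instance {n p d : ℕ} (Z : Mat n p) : IsProbabilityMeasure (latentPrior d Z) := by
  refine Measure.isProbabilityMeasure_map (Measurable.aemeasurable ?_)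
  fun_prop

theorem measurableSet_boundedCentred (n d : ℕ) (c₅ c₆ : ℝ) :
    MeasurableSet (boundedCentred n d c₅ c₆) := by
  have : boundedCentred n d c₅ c₆ =
      (⋂ i, ⋂ k, {X : Mat n d | |X i k| ≤ c₅}) ∩ ⋂ k, {X | |∑ i, X i k| ≤ c₆} := by
    ext; simp [boundedCentred]
  rw [this]
  exact (MeasurableSet.iInter fun i => MeasurableSet.iInter fun k =>
    measurableSet_le (by fun_prop) measurable_const).inter
    (MeasurableSet.iInter fun k => measurableSet_le (by fun_prop) measurable_const)

/-- Split `X = ZB + (X - ZB)`. Both `B` and the residual are row-sparse, so the small-ball bound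
applies to each of the two independent horseshoe layers; `Z` amplifies the error in `B` by at most
`p z`. -/
theorem latentPrior_ball_ge {n p d N a sb sx : ℕ} (hN : 2 ≤ N) (hd : 0 < d) (hpN : p ≤ N)
    (hnN : n ≤ N) (hdN : d ≤ N) (Z : Mat n p) (B : Mat p d) (X : Mat n d) {z η : ℝ}
    (hZ : ∀ i j, |Z i j| ≤ z) (hB : ∀ j k, |B j k| ≤ (N : ℝ) ^ a)
    (hU : ∀ i k, |X i k - matMul Z B i k| ≤ (N : ℝ) ^ a)
    (hsx : (Finset.univ.filter fun i => X i ≠ matMul Z B i).card ≤ sx)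
    (hsb : (Finset.univ.filter fun j => B j ≠ 0).card ≤ sb)
    (hη : (p * z + 1) * ((N : ℝ) ^ a)⁻¹ ≤ η) :
    ((N : ℝ) ^ ((8 * a + 30) * ((2 + sb + sx) * d)))⁻¹ ≤
      (latentPrior d Z).real {V | ∀ i k, |V i k - X i k| ≤ η} := by
  have h1 := horseshoe_smallBall hN hd hpN hdN B hB hsb
  have h2 := horseshoe_smallBall hN hd hnN hdN (fun i k => X i k - matMul Z B i k) hU
    (s := sx) (by
      refine le_trans (Finset.card_le_card ?_) hsx
      intro i
      simp only [Finset.mem_filter, Finset.mem_univ, true_and]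
      contrapose!
      intro h
      ext k
      simp [h])
  rw [latentPrior, map_measureReal_apply (by fun_prop) (measurableSet_entrywise_ball X η)]
  have h3 : (8 * a + 30) * ((2 + sb + sx) * d) =
      (8 * a + 30) * ((1 + sb) * d) + (8 * a + 30) * ((1 + sx) * d) := by ring
  rw [h3, pow_add, mul_inv]
  refine (mul_le_mul h1 h2 (by positivity) measureReal_nonneg).trans ?_
  rw [← measureReal_prod_prod]
  refine measureReal_mono ?_
  rintro ⟨W, V⟩ ⟨hW, hV⟩ i k
  simp only [Set.mem_ofPred_eq] at hW hV ⊢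
  have h4 : (∑ j, Z i j * W j k) + V i k - X i k =
      (∑ j, Z i j * (W j k - B j k)) + (V i k - (X i k - matMul Z B i k)) := by
    simp only [mul_sub, Finset.sum_sub_distrib, matMul]
    ring
  rw [h4]
  have h5 : |∑ j, Z i j * (W j k - B j k)| ≤ p * z * ((N : ℝ) ^ a)⁻¹ := by
    refine (Finset.abs_sum_le_sum_abs _ _).trans ?_
    calc _ ≤ ∑ _j : Fin p, z * ((N : ℝ) ^ a)⁻¹ := by
          refine Finset.sum_le_sum fun j _ => ?_
          rw [abs_mul]
          exact mul_le_mul (hZ i j) (hW j k) (abs_nonneg _) ((abs_nonneg _).trans (hZ i j))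
      _ = _ := by simp [mul_assoc]
  refine (abs_add_le _ _).trans ((add_le_add h5 (hV i k)).trans (le_trans (le_of_eq ?_) hη))
  ring

theorem le_cond_real {Ω : Type*} [MeasurableSpace Ω] (μ : Measure Ω) [IsProbabilityMeasure μ]
    {s t : Set Ω} (hs : MeasurableSet s) (hts : t ⊆ s) : μ.real t ≤ (cond μ s).real t := by
  have hc : (cond μ s).real t = (μ.real s)⁻¹ * μ.real t := by
    rw [Measure.real, cond_apply hs, Set.inter_eq_right.2 hts, ENNReal.toReal_mul,
      ENNReal.toReal_inv]
    rfl
  rw [hc]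
  rcases measureReal_nonneg (μ := μ) (s := s) |>.eq_or_lt with h | h
  · have : μ.real t ≤ 0 := h ▸ measureReal_mono hts
    rw [← h]
    simpa using this
  · exact le_mul_of_one_le_left measureReal_nonneg ((one_le_inv₀ h).2 measureReal_le_one)

/-- The small ball around the centred truth lies inside the conditioning event, so conditioning can
only increase its mass. Its product with an interval for the intercept is the neighbourhood `G`. -/
theorem jointPrior_concentration {n p d N a sb sx : ℕ} (hn : 0 < n) (hN : 2 ≤ N) (hd : 0 < d)
    (hpN : p ≤ N) (hnN : n ≤ N) (hdN : d ≤ N) (Z : Mat n p) (B : Mat p d) (X : Mat n d)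
    {z η c₁ c₅ c₆ R α β₀ Cβ r t q : ℝ}
    (hZ : ∀ i j, |Z i j| ≤ z) (hB : ∀ j k, |B j k| ≤ (N : ℝ) ^ a)
    (hU : ∀ i k, |X i k - matMul Z B i k| ≤ (N : ℝ) ^ a)
    (hsx : (Finset.univ.filter fun i => X i ≠ matMul Z B i).card ≤ sx)
    (hsb : (Finset.univ.filter fun j => B j ≠ 0).card ≤ sb)
    (hη : (p * z + 1) * ((N : ℝ) ^ a)⁻¹ ≤ η) (hX : ∀ i k, |X i k| ≤ c₁)
    (hX0 : ∀ k, ∑ i, X i k = 0) (hη5 : c₁ + η ≤ c₅) (hη6 : n * η ≤ c₆) (hη0 : 0 ≤ η)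
    (hα : 0 < α) (hα1 : α < 1) (hR : d * c₅ ^ 2 ≤ R) (hβ : β₀ ≤ Cβ) (hr : 1 ≤ r)
    (ν : Measure ℝ) [IsProbabilityMeasure ν] (hq : q ≤ ν.real {b | |b - β₀| ≤ t})
    (hmass : Real.exp (-r) ≤ ((N : ℝ) ^ ((8 * a + 30) * ((2 + sb + sx) * d)))⁻¹ * q)
    (ht1 : t + d * (2 * c₅ * η) ≤ 1) (htr : 3 * ((n : ℝ) ^ 2 * (t + d * (2 * c₅ * η)) ^ 2) ≤ r) :
    1 - 2 * Real.exp (-r) ≤ (networkLaw β₀ X).real {Y | ∀ U : Mat n d,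
      IsBayesEstimate (fractionalPosterior α (jointPrior d Z c₅ c₆ ν) Y) U →
      affinityRate α R Cβ * Real.exp β₀ * ((n : ℝ) ^ 2 * innerProductLoss U X) ≤
        4 * (5 * r + affinityRate α R Cβ * Real.exp β₀ * (d * c₆ ^ 2) ^ 2)} := by
  set ball : Set (Mat n d) := {V | ∀ i k, |V i k - X i k| ≤ η} with hball
  have hsub : ball ⊆ boundedCentred n d c₅ c₆ := by
    intro V hV
    refine ⟨fun i k => ?_, fun k => ?_⟩
    · have h1 : |V i k| ≤ |V i k - X i k| + |X i k| := by
        simpa using abs_add_le (V i k - X i k) (X i k)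
      linarith [hV i k, hX i k]
    · have h1 : ∑ i, V i k = ∑ i, (V i k - X i k) := by
        rw [Finset.sum_sub_distrib, hX0, sub_zero]
      rw [h1]
      refine (Finset.abs_sum_le_sum_abs _ _).trans (le_trans ?_ hη6)
      calc ∑ i, |V i k - X i k| ≤ ∑ _i : Fin n, η := Finset.sum_le_sum fun i _ => hV i k
        _ = _ := by simp
  have hlat := latentPrior_ball_ge hN hd hpN hnN hdN Z B X hZ hB hU hsx hsb hη
  have hN0 : (0 : ℝ) < N := by exact_mod_cast (by omega : 0 < N)
  have hball0 : 0 < (latentPrior d Z).real ball := lt_of_lt_of_le (by positivity) hlat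
  -- The conditioned prior is a probability measure only if its conditioning event is not null.
  have hbc0 : latentPrior d Z (boundedCentred n d c₅ c₆) ≠ 0 := by
    intro h
    have h1 : (latentPrior d Z).real (boundedCentred n d c₅ c₆) = 0 := by simp [Measure.real, h]
    have := measureReal_mono (μ := latentPrior d Z) hsub
    linarith
  have : IsProbabilityMeasure (cond (latentPrior d Z) (boundedCentred n d c₅ c₆)) :=
    cond_isProbabilityMeasure hbc0
  have : IsProbabilityMeasure (jointPrior d Z c₅ c₆ ν) := by
    unfold jointPrior
    infer_instance
  have hbm : MeasurableSet {b : ℝ | |b - β₀| ≤ t} :=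
    measurableSet_le (by fun_prop) measurable_const
  have hsupp : ∀ᵐ θ ∂(jointPrior d Z c₅ c₆ ν), θ.1 ∈ boundedCentred n d c₅ c₆ := by
    have h1 : ∀ᵐ V ∂(cond (latentPrior d Z) (boundedCentred n d c₅ c₆)),
        V ∈ boundedCentred n d c₅ c₆ :=
      ae_cond_mem (measurableSet_boundedCentred n d c₅ c₆)
    exact Measure.quasiMeasurePreserving_fst.ae h1
  have hc5 : ∀ i k, |X i k| ≤ c₅ := fun i k => (hX i k).trans (by linarith)
  refine bayes_loss_concentration hn hα hα1 hc5 hX0 hR hβ hr (jointPrior d Z c₅ c₆ ν) hsupp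
    (G := ball ×ˢ {b | |b - β₀| ≤ t}) ((measurableSet_entrywise_ball X η).prod hbm) ?_ ?_
  · rw [jointPrior, measureReal_prod_prod]
    refine hmass.trans ?_
    refine (mul_le_mul_of_nonneg_left hq (by positivity)).trans ?_
    refine mul_le_mul_of_nonneg_right ?_ measureReal_nonneg
    exact hlat.trans (le_cond_real _ (measurableSet_boundedCentred n d c₅ c₆) hsub)
  · rintro ⟨V, b⟩ ⟨hV, hb⟩
    simp only [Set.mem_ofPred_eq] at hb
    have hV5 := (hsub hV).1
    have habs : ∀ e, |linkLogit b V e - linkLogit β₀ X e| ≤ t + d * (2 * c₅ * η) := by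
      intro e
      rw [linkLogit_sub]
      exact (abs_add_le _ _).trans (add_le_add hb (abs_gramDiff_le hV5 hc5 hV _ _))
    refine ⟨fun e => (habs e).trans ht1, le_trans ?_ htr⟩
    refine mul_le_mul_of_nonneg_left ?_ (by norm_num)
    calc ∑ e, (linkLogit b V e - linkLogit β₀ X e) ^ 2
        ≤ ∑ _e : NodePair n, (t + d * (2 * c₅ * η)) ^ 2 := by
          refine Finset.sum_le_sum fun e _ => ?_
          rw [← sq_abs]
          exact pow_le_pow_left₀ (abs_nonneg _) (habs e) 2
      _ ≤ ∑ _i : Fin n, ∑ _j : Fin n, (t + d * (2 * c₅ * η)) ^ 2 :=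
          sum_nodePair_le (f := fun _ => (t + d * (2 * c₅ * η)) ^ 2) fun _ => sq_nonneg _
      _ = _ := by simp; ring

/-! ### Recovery of the positions up to a linear map -/

section LinearAlgebra
open Matrix

theorem dotProduct_sq_le {ι : Type*} [Fintype ι] (v w : ι → ℝ) :
    (v ⬝ᵥ w) ^ 2 ≤ (v ⬝ᵥ v) * (w ⬝ᵥ w) := by
  have := Finset.sum_mul_sq_le_sq_mul_sq Finset.univ v w
  simpa [dotProduct, sq] using this

theorem le_of_sq_le_mul {x y : ℝ} (hx : 0 ≤ x) (hy : 0 ≤ y) (h : x ^ 2 ≤ y * x) : x ≤ y := by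
  rcases hx.eq_or_lt with h0 | h0
  · rw [← h0]; exact hy
  · exact le_of_mul_le_mul_right (by rwa [← sq]) h0

theorem dotProduct_self_nonneg' {ι : Type*} [Fintype ι] (v : ι → ℝ) : 0 ≤ v ⬝ᵥ v :=
  Finset.sum_nonneg fun _ _ => mul_self_nonneg _

theorem mulVec_bijective_of_le {d : ℕ} {Q : Matrix (Fin d) (Fin d) ℝ} {c : ℝ} (hc : 0 < c)
    (h : ∀ u, c * (u ⬝ᵥ u) ≤ (Q *ᵥ u) ⬝ᵥ (Q *ᵥ u)) : Function.Bijective Q.mulVec := by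
  have hinj : Function.Injective Q.mulVecLin := by
    rw [← LinearMap.ker_eq_bot, LinearMap.ker_eq_bot']
    intro u hu
    have h1 := h u
    rw [Matrix.mulVecLin_apply] at hu
    rw [hu, zero_dotProduct] at h1
    have h2 : u ⬝ᵥ u = 0 := le_antisymm (by nlinarith) (dotProduct_self_nonneg' u)
    exact dotProduct_self_eq_zero.1 h2
  exact ⟨hinj, LinearMap.injective_iff_surjective.1 hinj⟩

/-- A square matrix and its transpose have the same singular values; here surjectivity of `Q` and
Cauchy–Schwarz for `w ⬝ᵥ w = u ⬝ᵥ Qᵀ w` replace the spectral theorem. -/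
theorem transpose_mulVec_lower {d : ℕ} {Q : Matrix (Fin d) (Fin d) ℝ} {c : ℝ} (hc : 0 < c)
    (h : ∀ u, c * (u ⬝ᵥ u) ≤ (Q *ᵥ u) ⬝ᵥ (Q *ᵥ u)) (w : Fin d → ℝ) :
    c * (w ⬝ᵥ w) ≤ (Qᵀ *ᵥ w) ⬝ᵥ (Qᵀ *ᵥ w) := by
  obtain ⟨u, rfl⟩ := (mulVec_bijective_of_le hc h).2 w
  set w := Q *ᵥ u
  have h1 : w ⬝ᵥ w = u ⬝ᵥ (Qᵀ *ᵥ w) := by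
    rw [mulVec_transpose, dotProduct_comm u, ← dotProduct_mulVec]
  have h2 := dotProduct_sq_le u (Qᵀ *ᵥ w)
  rw [← h1] at h2
  have h3 := h u
  have h4 := dotProduct_self_nonneg' (Qᵀ *ᵥ w)
  refine le_of_sq_le_mul (mul_nonneg hc.le (dotProduct_self_nonneg' w)) h4 ?_
  calc (c * (w ⬝ᵥ w)) ^ 2 = c * (c * (w ⬝ᵥ w) ^ 2) := by ring
    _ ≤ c * (c * ((u ⬝ᵥ u) * ((Qᵀ *ᵥ w) ⬝ᵥ (Qᵀ *ᵥ w)))) := by gcongr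
    _ = c * (((Qᵀ *ᵥ w) ⬝ᵥ (Qᵀ *ᵥ w)) * (c * (u ⬝ᵥ u))) := by ring
    _ ≤ c * (((Qᵀ *ᵥ w) ⬝ᵥ (Qᵀ *ᵥ w)) * (w ⬝ᵥ w)) := by gcongr
    _ = _ := by ring

theorem transpose_mulVec_upper {d : ℕ} {Q : Matrix (Fin d) (Fin d) ℝ} {c : ℝ} (hc : 0 ≤ c)
    (h : ∀ u, (Q *ᵥ u) ⬝ᵥ (Q *ᵥ u) ≤ c * (u ⬝ᵥ u)) (w : Fin d → ℝ) :
    (Qᵀ *ᵥ w) ⬝ᵥ (Qᵀ *ᵥ w) ≤ c * (w ⬝ᵥ w) := by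
  set z := Qᵀ *ᵥ w with hz
  have h1 : z ⬝ᵥ z = w ⬝ᵥ (Q *ᵥ z) := by
    rw [dotProduct_mulVec w Q z, ← mulVec_transpose]
  have h2 := dotProduct_sq_le w (Q *ᵥ z)
  rw [← h1] at h2
  have h3 := h z
  have h4 := dotProduct_self_nonneg' w
  refine le_of_sq_le_mul (dotProduct_self_nonneg' z) (mul_nonneg hc h4) ?_
  nlinarith

theorem frobenius_mulVec_le {m n : ℕ} (A : Matrix (Fin m) (Fin n) ℝ) (y : Fin n → ℝ) :
    (A *ᵥ y) ⬝ᵥ (A *ᵥ y) ≤ (∑ i, ∑ j, A i j ^ 2) * (y ⬝ᵥ y) := by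
  rw [Finset.sum_mul]
  refine Finset.sum_le_sum fun i _ => ?_
  have := dotProduct_sq_le (A i) y
  have h : A i ⬝ᵥ A i = ∑ j, A i j ^ 2 := by simp [dotProduct, sq]
  rw [h] at this
  rw [← sq]
  exact this

/-- With `P = X (XᵀX)⁻¹` and `Q = Uᵀ P`, the identity `Xᵀ P = 1` gives `‖Qu‖² - ‖u‖² = (Pu)ᵀ D (Pu)`
and `UQ - X = D P`. Neither an orthogonal alignment nor a perturbation bound for eigenvectors is
needed. -/
theorem exists_linear_alignment {n d : ℕ} (U X : Matrix (Fin n) (Fin d) ℝ) {σ E : ℝ} (hσ : 0 < σ)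
    (hX : ∀ u, σ * (u ⬝ᵥ u) ≤ (X *ᵥ u) ⬝ᵥ (X *ᵥ u))
    (hE : ∑ i, ∑ j, (U * Uᵀ - X * Xᵀ) i j ^ 2 ≤ E) (hEσ : E ≤ σ ^ 2 / 4) :
    ∃ Q : Matrix (Fin d) (Fin d) ℝ,
      (∀ w, 1 / 2 * (w ⬝ᵥ w) ≤ (Qᵀ *ᵥ w) ⬝ᵥ (Qᵀ *ᵥ w)) ∧
      (∀ w, (Qᵀ *ᵥ w) ⬝ᵥ (Qᵀ *ᵥ w) ≤ 3 / 2 * (w ⬝ᵥ w)) ∧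
      σ * ∑ i, (Qᵀ *ᵥ U i - X i) ⬝ᵥ (Qᵀ *ᵥ U i - X i) ≤ E := by
  set G := Xᵀ * X with hG
  have hGdot : ∀ u v, u ⬝ᵥ (G *ᵥ v) = (X *ᵥ u) ⬝ᵥ (X *ᵥ v) := by
    intro u v
    rw [hG, ← mulVec_mulVec, dotProduct_mulVec, vecMul_transpose]
  have hGinj : Function.Injective G.mulVec := by
    have : Function.Injective G.mulVecLin := by
      rw [← LinearMap.ker_eq_bot, LinearMap.ker_eq_bot']
      intro u hu
      rw [mulVecLin_apply] at hu
      have h1 := hX u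
      rw [← hGdot, hu, dotProduct_zero] at h1
      exact dotProduct_self_eq_zero.1
        (le_antisymm (by nlinarith) (dotProduct_self_nonneg' u))
    exact this
  have hGu : IsUnit G.det := (Matrix.isUnit_iff_isUnit_det G).1 (mulVec_injective_iff_isUnit.1 hGinj)
  have hGT : Gᵀ = G := by rw [hG, transpose_mul, transpose_transpose]
  set P := X * G⁻¹ with hP
  have hXP : Xᵀ * P = 1 := by
    rw [hP, ← Matrix.mul_assoc, ← hG, mul_nonsing_inv _ hGu]
  set D := U * Uᵀ - X * Xᵀ with hD
  set Q := Uᵀ * P with hQ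
  have hPu : ∀ u, σ * ((P *ᵥ u) ⬝ᵥ (P *ᵥ u)) ≤ u ⬝ᵥ u := by
    intro u
    set v := G⁻¹ *ᵥ u with hv
    have hu : G *ᵥ v = u := by
      rw [hv, mulVec_mulVec, mul_nonsing_inv _ hGu, one_mulVec]
    have h1 : P *ᵥ u = X *ᵥ v := by rw [hP, hv, mulVec_mulVec]
    rw [h1]
    have h2 := dotProduct_sq_le v u
    rw [← hu, hGdot, hu] at h2
    have h3 := hX v
    have h4 := dotProduct_self_nonneg' (X *ᵥ v)
    have h5 := dotProduct_self_nonneg' u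
    refine le_of_sq_le_mul (mul_nonneg hσ.le h4) h5 ?_
    calc (σ * ((X *ᵥ v) ⬝ᵥ (X *ᵥ v))) ^ 2 = σ * (σ * ((X *ᵥ v) ⬝ᵥ (X *ᵥ v)) ^ 2) := by ring
      _ ≤ σ * (σ * ((v ⬝ᵥ v) * (u ⬝ᵥ u))) := by gcongr
      _ = σ * (σ * (v ⬝ᵥ v)) * (u ⬝ᵥ u) := by ring
      _ ≤ σ * ((X *ᵥ v) ⬝ᵥ (X *ᵥ v)) * (u ⬝ᵥ u) := by gcongr
      _ = _ := by ring
  have hQu : ∀ u, |(Q *ᵥ u) ⬝ᵥ (Q *ᵥ u) - u ⬝ᵥ u| ≤ 1 / 2 * (u ⬝ᵥ u) := by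
    intro u
    set y := P *ᵥ u with hy
    have h1 : (Q *ᵥ u) ⬝ᵥ (Q *ᵥ u) = y ⬝ᵥ ((U * Uᵀ) *ᵥ y) := by
      rw [hQ, ← mulVec_mulVec, ← hy, ← mulVec_mulVec, dotProduct_mulVec y U, mulVec_transpose]
    have h2 : u ⬝ᵥ u = y ⬝ᵥ ((X * Xᵀ) *ᵥ y) := by
      have : u = Xᵀ *ᵥ y := by rw [hy, mulVec_mulVec, hXP, one_mulVec]
      rw [← mulVec_mulVec, dotProduct_mulVec y X, ← mulVec_transpose, ← this]
    have h3 : (Q *ᵥ u) ⬝ᵥ (Q *ᵥ u) - u ⬝ᵥ u = y ⬝ᵥ (D *ᵥ y) := by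
      rw [h1, h2, ← dotProduct_sub, ← sub_mulVec]
    rw [h3]
    refine abs_le_of_sq_le_sq ?_ (by linarith [dotProduct_self_nonneg' u])
    have h4 := dotProduct_sq_le y (D *ᵥ y)
    have h5 := frobenius_mulVec_le D y
    have h6 := hPu u
    have h7 := dotProduct_self_nonneg' y
    have h8 : (D *ᵥ y) ⬝ᵥ (D *ᵥ y) ≤ σ ^ 2 / 4 * (y ⬝ᵥ y) :=
      h5.trans (mul_le_mul_of_nonneg_right (hE.trans hEσ) h7)
    -- The distortion is at most `‖D‖ ‖y‖² ≤ (σ/2)(‖u‖²/σ)`.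
    calc (y ⬝ᵥ (D *ᵥ y)) ^ 2 ≤ (y ⬝ᵥ y) * (σ ^ 2 / 4 * (y ⬝ᵥ y)) :=
          h4.trans (mul_le_mul_of_nonneg_left h8 h7)
      _ = (1 / 2 * (σ * (y ⬝ᵥ y))) ^ 2 := by ring
      _ ≤ (1 / 2 * (u ⬝ᵥ u)) ^ 2 := by gcongr
  refine ⟨Q, transpose_mulVec_lower (by norm_num) fun u => ?_,
    transpose_mulVec_upper (by norm_num) fun u => ?_, ?_⟩
  · linarith [(abs_le.1 (hQu u)).1]
  · linarith [(abs_le.1 (hQu u)).2]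
  · refine le_trans ?_ hE
    rw [Finset.mul_sum]
    refine Finset.sum_le_sum fun i _ => ?_
    set w := Qᵀ *ᵥ U i - X i with hw
    have hUQ : U * Q - X = D * P := by
      rw [hD, Matrix.sub_mul, hQ, Matrix.mul_assoc X, hXP, Matrix.mul_one, Matrix.mul_assoc]
    have hw' : w = Pᵀ *ᵥ D i := by
      have h1 := congrFun hUQ i
      rw [mulVec_transpose]
      rw [hw, mulVec_transpose]
      exact h1
    -- These normal equations say that `X w` is the orthogonal projection of row `i` of `D` onto the
    -- column space of `X`, so it is no longer than that row.
    have hGw : G *ᵥ w = Xᵀ *ᵥ D i := by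
      rw [hw', mulVec_mulVec, hP, transpose_mul, transpose_nonsing_inv, hGT, ← Matrix.mul_assoc,
        mul_nonsing_inv _ hGu, Matrix.one_mul]
    have h1 : (X *ᵥ w) ⬝ᵥ (X *ᵥ w) = (X *ᵥ w) ⬝ᵥ D i := by
      rw [← hGdot, hGw, dotProduct_mulVec, vecMul_transpose]
    have h2 := dotProduct_sq_le (X *ᵥ w) (D i)
    have h3 : D i ⬝ᵥ D i = ∑ j, D i j ^ 2 := by simp [dotProduct, sq]
    rw [← h3]
    refine (hX w).trans ?_
    rw [← h1] at h2
    refine le_of_sq_le_mul (dotProduct_self_nonneg' _) (dotProduct_self_nonneg' _) ?_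
    linarith

theorem smallestSingularValue_sq_mul_le {n d : ℕ} (hd : 0 < d) (X : Mat n d) (u : Fin d → ℝ) :
    smallestSingularValue X ^ 2 * (u ⬝ᵥ u) ≤ (Matrix.of X *ᵥ u) ⬝ᵥ (Matrix.of X *ᵥ u) := by
  set T := Matrix.toEuclideanLin (Matrix.of X) with hT
  have hfr : Module.finrank ℝ (EuclideanSpace ℝ (Fin d)) = d := by simp
  set S := T.isSymmetric_adjoint_comp_self with hS
  have hlt : d - 1 < d := by omega
  have hsv : smallestSingularValue X ^ 2 = S.eigenvalues hfr ⟨d - 1, hlt⟩ :=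
    T.sq_singularValues_of_lt hfr hlt
  set x : EuclideanSpace ℝ (Fin d) := WithLp.toLp 2 u with hx
  have h1 : (Matrix.of X *ᵥ u) ⬝ᵥ (Matrix.of X *ᵥ u) = inner ℝ (T x) (T x) := by
    rw [EuclideanSpace.inner_eq_star_dotProduct]
    simp [hT, hx, Matrix.toLpLin_apply]
  have h2 : u ⬝ᵥ u = ∑ i, (S.eigenvectorBasis hfr).repr x i ^ 2 := by
    have h3 : ‖(S.eigenvectorBasis hfr).repr x‖ = ‖x‖ := LinearIsometryEquiv.norm_map _ _
    have h4 : ‖x‖ ^ 2 = u ⬝ᵥ u := by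
      rw [EuclideanSpace.real_norm_sq_eq]
      simp [hx, dotProduct, sq]
    rw [← h4, ← h3, EuclideanSpace.real_norm_sq_eq]
  have h5 : inner ℝ (T x) (T x) =
      ∑ i, S.eigenvalues hfr i * (S.eigenvectorBasis hfr).repr x i ^ 2 := by
    rw [← LinearMap.adjoint_inner_left, ← LinearMap.comp_apply,
      ← LinearIsometryEquiv.inner_map_map (S.eigenvectorBasis hfr).repr]
    rw [PiLp.inner_apply]
    refine Finset.sum_congr rfl fun i _ => ?_
    rw [LinearMap.IsSymmetric.eigenvectorBasis_apply_self_apply]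
    simp
    ring
  rw [h1, h5, h2, hsv, Finset.mul_sum]
  refine Finset.sum_le_sum fun i _ => mul_le_mul_of_nonneg_right ?_ (sq_nonneg _)
  refine S.eigenvalues_antitone hfr ?_
  rw [Fin.le_def]
  have := i.2
  show (i : ℕ) ≤ d - 1
  omega

/-! ### K-means -/

theorem dotProduct_self_sub {d : ℕ} (v w : Fin d → ℝ) :
    (v - w) ⬝ᵥ (v - w) = ∑ k, (v k - w k) ^ 2 := by
  simp [dotProduct, sq]

/-- The true labels with the centers pulled back through `Qᵀ` have K-means cost at most `2F`, so the
fitted solution does too. Mapping its centers forward by `Qᵀ` gives `2F + 2 · (3/2) · 2F = 8F`. -/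
theorem kmeans_centers_close {n d K : ℕ} (U X : Mat n d) (g ghat : Fin n → Fin K) (C : Mat K d)
    (hXC : ∀ i, X i = C (g i)) (hk : IsKMeans U ghat) {σ E : ℝ} (hσ : 0 < σ)
    (hX : ∀ u, σ * (u ⬝ᵥ u) ≤ (Matrix.of X *ᵥ u) ⬝ᵥ (Matrix.of X *ᵥ u))
    (hE : ∑ i, ∑ j, gramDiff U X i j ^ 2 ≤ E) (hEσ : E ≤ σ ^ 2 / 4) :
    ∃ C' : Mat K d, ∑ i, ∑ k, (X i k - C' (ghat i) k) ^ 2 ≤ 8 * (E / σ) := by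
  obtain ⟨Q, hQ1, hQ2, hQ3⟩ := exists_linear_alignment (Matrix.of U) (Matrix.of X) hσ hX hE hEσ
  set F := ∑ i, (Qᵀ *ᵥ U i - X i) ⬝ᵥ (Qᵀ *ᵥ U i - X i) with hF
  have hFE : F ≤ E / σ := by
    rw [le_div_iff₀ hσ, mul_comm]
    exact hQ3
  choose A hA using fun k => (mulVec_bijective_of_le (by norm_num) hQ1).2 (C k)
  obtain ⟨Chat, hChat⟩ := hk
  have h1 := hChat g A
  simp_rw [← dotProduct_self_sub] at h1
  have h2 : ∑ i, (U i - A (g i)) ⬝ᵥ (U i - A (g i)) ≤ 2 * F := by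
    rw [hF, Finset.mul_sum]
    refine Finset.sum_le_sum fun i _ => ?_
    have := hQ1 (U i - A (g i))
    rw [mulVec_sub, hA, ← hXC] at this
    linarith
  refine ⟨fun k => Qᵀ *ᵥ Chat k, le_trans ?_ (mul_le_mul_of_nonneg_left hFE (by norm_num))⟩
  have h3 : ∀ i, ∑ k, (X i k - (Qᵀ *ᵥ Chat (ghat i)) k) ^ 2 ≤
      2 * ((Qᵀ *ᵥ U i - X i) ⬝ᵥ (Qᵀ *ᵥ U i - X i)) +
      3 * ((U i - Chat (ghat i)) ⬝ᵥ (U i - Chat (ghat i))) := by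
    intro i
    have h4 := hQ2 (U i - Chat (ghat i))
    rw [mulVec_sub, dotProduct_self_sub] at h4
    rw [dotProduct_self_sub (Qᵀ *ᵥ U i)]
    have h5 : ∑ k, (X i k - (Qᵀ *ᵥ Chat (ghat i)) k) ^ 2 ≤
        ∑ k, (2 * ((Qᵀ *ᵥ U i) k - X i k) ^ 2 +
          2 * ((Qᵀ *ᵥ U i) k - (Qᵀ *ᵥ Chat (ghat i)) k) ^ 2) :=
      Finset.sum_le_sum fun k _ => by
        nlinarith [sq_nonneg (((Qᵀ *ᵥ U i) k - X i k) +
          ((Qᵀ *ᵥ U i) k - (Qᵀ *ᵥ Chat (ghat i)) k))]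
    rw [Finset.sum_add_distrib, ← Finset.mul_sum, ← Finset.mul_sum] at h5
    linarith
  have h6 := Finset.sum_le_sum fun i (_ : i ∈ Finset.univ) => h3 i
  rw [Finset.sum_add_distrib, ← Finset.mul_sum, ← Finset.mul_sum, ← hF] at h6
  linarith

end LinearAlgebra

/-- Let `S` be the nodes at distance at least `δ/2` from their fitted center; there are at most
`4T/δ²` of them. Outside `S` a shared fitted label forces a shared true label, by separation. Every
block exceeds `S` in size and so has a representative outside it. The fitted labels of the
representatives are thus distinct and define a permutation that is correct off `S`. -/
theorem misclustered_le {n d K : ℕ} (X : Mat n d) (g ghat : Fin n → Fin K) (C C' : Mat K d)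
    (hXC : ∀ i, X i = C (g i)) (hC : Function.Injective C) {δ T : ℝ} (hδ : 0 < δ)
    (hsep : ∀ i j, X i ≠ X j → δ ≤ √(∑ k, (X i k - X j k) ^ 2))
    (hT : ∑ i, ∑ k, (X i k - C' (ghat i) k) ^ 2 ≤ T)
    (hblock : 4 * T / δ ^ 2 < minBlockSize g) :
    (misclustered ghat g : ℝ) ≤ 4 * T / δ ^ 2 := by
  classical
  set S := Finset.univ.filter fun i => δ ^ 2 / 4 ≤ ∑ k, (X i k - C' (ghat i) k) ^ 2 with hS
  have hScard : (S.card : ℝ) ≤ 4 * T / δ ^ 2 := by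
    rw [le_div_iff₀ (by positivity)]
    have h1 : S.card * (δ ^ 2 / 4) ≤ ∑ i ∈ S, ∑ k, (X i k - C' (ghat i) k) ^ 2 := by
      rw [← nsmul_eq_mul]
      exact Finset.card_nsmul_le_sum _ _ _ fun i hi => (Finset.mem_filter.1 hi).2
    have h2 : ∑ i ∈ S, ∑ k, (X i k - C' (ghat i) k) ^ 2 ≤ T :=
      (Finset.sum_le_sum_of_subset_of_nonneg (Finset.filter_subset _ _)
        fun i _ _ => Finset.sum_nonneg fun k _ => sq_nonneg _).trans hT
    linarith
  have hrep : ∀ k, ∃ i, i ∉ S ∧ g i = k := by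
    intro k
    by_contra! hcon
    have h1 : (Finset.univ.filter fun i => g i = k) ⊆ S := by
      intro i hi
      by_contra h
      exact hcon i h (Finset.mem_filter.1 hi).2
    have h2 : minBlockSize g ≤ S.card :=
      (ciInf_le' _ k).trans (Finset.card_le_card h1)
    have h3 : (minBlockSize g : ℝ) ≤ S.card := by exact_mod_cast h2
    linarith
  have hsame : ∀ i j, i ∉ S → j ∉ S → ghat i = ghat j → g i = g j := by
    intro i j hi hj hij
    refine hC ?_
    rw [← hXC, ← hXC]
    by_contra hne
    have h1 := hsep i j hne
    simp only [hS, Finset.mem_filter, Finset.mem_univ, true_and, not_le] at hi hj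
    rw [hij] at hi
    have h2 : ∑ k, (X i k - X j k) ^ 2 ≤
        2 * ∑ k, (X i k - C' (ghat j) k) ^ 2 + 2 * ∑ k, (X j k - C' (ghat j) k) ^ 2 := by
      rw [Finset.mul_sum, Finset.mul_sum, ← Finset.sum_add_distrib]
      refine Finset.sum_le_sum fun k _ => ?_
      nlinarith [sq_nonneg ((X i k - C' (ghat j) k) + (X j k - C' (ghat j) k))]
    have h3 : δ ^ 2 ≤ ∑ k, (X i k - X j k) ^ 2 :=
      (Real.le_sqrt hδ.le (Finset.sum_nonneg fun k _ => sq_nonneg _)).1 h1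
    linarith
  choose rep hrepS hrepg using hrep
  have hinj : Function.Injective fun k => ghat (rep k) := by
    intro k l hkl
    rw [← hrepg k, ← hrepg l]
    exact hsame _ _ (hrepS k) (hrepS l) hkl
  let e : Equiv.Perm (Fin K) := Equiv.ofBijective _ (Finite.injective_iff_bijective.1 hinj)
  have hle : misclustered ghat g ≤ S.card := by
    refine (Finset.inf'_le _ (Finset.mem_univ e.symm)).trans (Finset.card_le_card ?_)
    intro i hi
    by_contra hiS
    refine (Finset.mem_filter.1 hi).2 ?_
    obtain ⟨k, hk⟩ := e.surjective (ghat i)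
    have h1 : g i = k := by
      rw [← hrepg k]
      exact hsame i (rep k) hiS (hrepS k) hk.symm
    rw [← hk, Equiv.symm_apply_apply, h1]
  have : (misclustered ghat g : ℝ) ≤ S.card := by exact_mod_cast hle
  linarith

/-! ### Consequences of the assumptions on the design -/

/-- The eigenvalue bound is tested on a matrix with a single nonzero entry. -/
theorem abs_entry_le_of_eigenvalue_bound {n p d : ℕ} (hd : 0 < d) {Z : Mat n p} {c r : ℝ}
    (hr : 0 < r) (h : ∀ A : Mat p d, norm21 A ≤ r → frobSq (matMul Z A) ≤ c * n * frobSq A)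
    (i : Fin n) (j : Fin p) : |Z i j| ≤ √(c * n) := by
  set A : Mat p d := fun j' k => if j' = j then (if k = ⟨0, hd⟩ then r else 0) else 0 with hA
  have h1 : ∀ j', ∑ k, A j' k ^ 2 = if j' = j then r ^ 2 else 0 := by
    intro j'
    by_cases hj : j' = j <;> simp [hA, hj, ite_pow]
  have h2 : norm21 A = r := by
    simp only [norm21, h1]
    rw [Finset.sum_eq_single j (fun j' _ hj => by simp [hj]) (by simp)]
    simp [Real.sqrt_sq hr.le]
  have h3 : frobSq A = r ^ 2 := by
    simp only [frobSq, h1]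
    simp
  have h4 : (Z i j * r) ^ 2 ≤ frobSq (matMul Z A) := by
    have h5 : matMul Z A i ⟨0, hd⟩ = Z i j * r := by
      simp [matMul, hA]
    rw [← h5]
    refine le_trans ?_ (Finset.single_le_sum (f := fun i => ∑ k, matMul Z A i k ^ 2)
      (fun i _ => Finset.sum_nonneg fun k _ => sq_nonneg _) (Finset.mem_univ i))
    exact Finset.single_le_sum (f := fun k => matMul Z A i k ^ 2) (fun k _ => sq_nonneg _)
      (Finset.mem_univ _)
  have h6 := h4.trans (h A h2.le)
  rw [h3, mul_pow] at h6
  exact Real.abs_le_sqrt (le_of_mul_le_mul_right h6 (by positivity))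

/-- Every column of `X` has squared norm at least `c² n`, while the rows allow a total of at most `n
c'²`. Hence the dimension stays bounded. -/
theorem dim_mul_sq_le {n d : ℕ} (hn : 0 < n) (hd : 0 < d) {X : Mat n d} {c c' : ℝ} (hc : 0 < c)
    (hsing : c * √(n : ℝ) ≤ smallestSingularValue X) (hX : ∀ i, √(∑ k, X i k ^ 2) ≤ c') :
    d ≤ c' ^ 2 / c ^ 2 := by
  have hn0 : (0 : ℝ) < n := by exact_mod_cast hn
  have h1 : ∀ k, c ^ 2 * n ≤ ∑ i, X i k ^ 2 := by
    intro k
    have h2 := smallestSingularValue_sq_mul_le hd X (Pi.single k 1)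
    have h3 : (Matrix.of X).mulVec (Pi.single k 1) ⬝ᵥ (Matrix.of X).mulVec (Pi.single k 1) =
        ∑ i, X i k ^ 2 := by
      simp [dotProduct, sq, Matrix.mulVec_single]
    rw [h3] at h2
    simp only [dotProduct_single, Pi.single_eq_same, mul_one] at h2
    refine le_trans ?_ h2
    calc c ^ 2 * n = (c * √(n : ℝ)) ^ 2 := by rw [mul_pow, Real.sq_sqrt hn0.le]
      _ ≤ _ := pow_le_pow_left₀ (by positivity) hsing 2
  have h4 : ∀ i, ∑ k, X i k ^ 2 ≤ c' ^ 2 := fun i => by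
    have h5 : 0 ≤ ∑ k, X i k ^ 2 := Finset.sum_nonneg fun k _ => sq_nonneg _
    calc _ = √(∑ k, X i k ^ 2) ^ 2 := (Real.sq_sqrt h5).symm
      _ ≤ _ := pow_le_pow_left₀ (Real.sqrt_nonneg _) (hX i) 2
  have h6 : (d : ℝ) * (c ^ 2 * n) ≤ n * c' ^ 2 := by
    calc (d : ℝ) * (c ^ 2 * n) = ∑ _k : Fin d, c ^ 2 * n := by simp
      _ ≤ ∑ k, ∑ i, X i k ^ 2 := Finset.sum_le_sum fun k _ => h1 k
      _ = ∑ i, ∑ k, X i k ^ 2 := Finset.sum_comm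
      _ ≤ ∑ _i : Fin n, c' ^ 2 := Finset.sum_le_sum fun i _ => h4 i
      _ = _ := by simp
  rw [le_div_iff₀ (by positivity)]
  nlinarith

theorem one_le_minBlockSize {n K : ℕ} (hn : 0 < n) {g : Fin n → Fin K}
    (hg : Function.Surjective g) : 1 ≤ minBlockSize g := by
  have : Nonempty (Fin K) := ⟨g ⟨0, hn⟩⟩
  refine le_ciInf fun k => ?_
  obtain ⟨i, hi⟩ := hg k
  exact Finset.card_pos.2 ⟨i, by simp [hi]⟩

theorem sq_mul_epsRate_sq (M₀ : ℝ) {n p : ℕ} (d sb sx : ℕ) (hn : 0 < n) (hp : 0 < p) :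
    (n : ℝ) ^ 2 * epsRate M₀ n p d sb sx ^ 2 =
      M₀ ^ 2 * ((1 + (sb : ℝ) + sx) * d * Real.log ((n : ℝ) * p)) := by
  have hn0 : (0 : ℝ) < n := by exact_mod_cast hn
  have h1 : (1 : ℝ) ≤ (n : ℝ) * p := by exact_mod_cast Nat.mul_pos hn hp
  have h2 := Real.log_nonneg h1
  rw [epsRate, mul_pow, Real.sq_sqrt (by positivity)]
  field_simp

theorem tendsto_sq_mul_epsRate_sq {M₀ : ℝ} (hM₀ : 0 < M₀) {d p sb sx : ℕ → ℕ} (hd : ∀ n, 0 < d n)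
    (hp : ∀ n, 0 < p n) :
    Tendsto (fun n : ℕ => (n : ℝ) ^ 2 * epsRate M₀ n (p n) (d n) (sb n) (sx n) ^ 2) atTop atTop := by
  have h1 : Tendsto (fun n : ℕ => M₀ ^ 2 * Real.log n) atTop atTop :=
    (Real.tendsto_log_atTop.comp tendsto_natCast_atTop_atTop).const_mul_atTop (by positivity)
  refine tendsto_atTop_mono' _ ?_ h1
  filter_upwards [eventually_gt_atTop 0] with n hn
  rw [sq_mul_epsRate_sq M₀ _ _ _ hn (hp n)]
  have hn1 : (1 : ℝ) ≤ n := by exact_mod_cast hn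
  have hp1 : (1 : ℝ) ≤ p n := by exact_mod_cast hp n
  have hd1 : (1 : ℝ) ≤ d n := by exact_mod_cast hd n
  have h2 : Real.log n ≤ Real.log ((n : ℝ) * p n) :=
    Real.log_le_log (by linarith) (le_mul_of_one_le_right (by linarith) hp1)
  have h3 : 0 ≤ Real.log n := Real.log_nonneg hn1
  refine mul_le_mul_of_nonneg_left (h2.trans ?_) (by positivity)
  refine le_mul_of_one_le_left (h3.trans h2) ?_
  refine one_le_mul_of_one_le_of_one_le ?_ hd1
  have : (0 : ℝ) ≤ sb n := by positivity
  have : (0 : ℝ) ≤ sx n := by positivity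
  linarith

/-! ### Contraction of the Bayes estimate -/

theorem exp_neg_le_prior_mass {N k m : ℕ} {s v c q w : ℝ} (hN : 1 ≤ N) (hc : Real.exp (-v) ≤ c)
    (hq : q = c * Real.exp (-v)) (hm : (m : ℝ) ≤ 2 * s) (hw : w = s * Real.log N) :
    Real.exp (-(2 * k * w + 2 * v)) ≤ ((N : ℝ) ^ (k * m))⁻¹ * q := by
  have hN0 : (0 : ℝ) < N := by exact_mod_cast hN
  have hlog : 0 ≤ Real.log N := Real.log_nonneg (by exact_mod_cast hN)
  have h1 : ((N : ℝ) ^ (k * m))⁻¹ = Real.exp (-(k * (m * Real.log N))) := by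
    rw [Real.exp_neg, ← mul_assoc, ← Nat.cast_mul, Real.exp_nat_mul, Real.exp_log hN0]
  have h2 : (k : ℝ) * (m * Real.log N) ≤ 2 * k * w := by
    rw [hw]
    calc (k : ℝ) * (m * Real.log N) ≤ k * (2 * s * Real.log N) := by gcongr
      _ = _ := by ring
  rw [h1, hq]
  calc Real.exp (-(2 * k * w + 2 * v)) = Real.exp (-(2 * k * w)) * (Real.exp (-v) * Real.exp (-v)) := by
        rw [← Real.exp_add, ← Real.exp_add]; congr 1; ring
    _ ≤ _ := by gcongr

theorem bayes_estimate_contraction (d p sb sx : ℕ → ℕ) (hd : ∀ n, 0 < d n) (hp : ∀ n, 0 < p n)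
    {α M₀ C₁ C₂ CB C₅ C₆ CRE RRE c₄ cβ Cβ D : ℝ} (hα : 0 < α ∧ α < 1) (hM₀ : 0 < M₀)
    (Z : ∀ n, Mat n (p n)) (X : ∀ n, Mat n (d n)) (B : ∀ n, Mat (p n) (d n)) (β : ℕ → ℝ)
    (hsx : ∀ n, (Finset.univ.filter fun i => X n i ≠ matMul (Z n) (B n) i).card ≤ sx n)
    (hsb : ∀ n, (Finset.univ.filter fun j => B n j ≠ 0).card ≤ sb n)
    (hε : Tendsto (fun n => epsRate M₀ n (p n) (d n) (sb n) (sx n)) atTop (𝓝 0))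
    (hC₁ : 0 < C₁) (hXinf : ∀ n i k, |X n i k| ≤ C₁)
    (hB : ∀ᶠ n in atTop, ∀ j k, |B n j k| ≤ CB * (p n : ℝ) ^ C₂)
    (hRRE : 0 < RRE)
    (hRE : ∀ᶠ n : ℕ in atTop, ∀ A : Mat (p n) (d n),
      norm21 A ≤ RRE * ((1 + (sb n : ℝ)) * d n * Real.log ((n : ℝ) * p n)) →
      frobSq (matMul (Z n) A) ≤ CRE * n * frobSq A)
    (hβle : ∀ n, β n ≤ Cβ) (priorβ : ℕ → Measure ℝ) (hprior : ∀ n, IsProbabilityMeasure (priorβ n))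
    (hcβ : 0 < cβ)
    (hmass : ∀ᶠ n : ℕ in atTop,
      cβ * Real.exp (-((n : ℝ) ^ 2 * epsRate M₀ n (p n) (d n) (sb n) (sx n) ^ 2)) ≤
        (priorβ n).real {b | |b - β n| ≤ c₄ * epsRate M₀ n (p n) (d n) (sb n) (sx n)})
    (hcent : ∀ n k, ∑ i, X n i k = 0) (hC₅ : C₁ < C₅) (hC₆ : 0 < C₆)
    (hD : ∀ᶠ n in atTop, (d n : ℝ) ≤ D) :
    ∃ ρ CL : ℝ, 0 < ρ ∧ 0 < CL ∧ ∀ᶠ n : ℕ in atTop,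
      1 - 2 * Real.exp (-(ρ * ((n : ℝ) ^ 2 * epsRate M₀ n (p n) (d n) (sb n) (sx n) ^ 2))) ≤
      (networkLaw (β n) (X n)).real {Y | ∀ U : Mat n (d n),
        IsBayesEstimate (fractionalPosterior α (jointPrior (d n) (Z n) C₅ C₆ (priorβ n)) Y) U →
        ∑ i, ∑ j, gramDiff U (X n) i j ^ 2 ≤ CL * (Real.exp (-β n) *
          ((n : ℝ) ^ 2 * epsRate M₀ n (p n) (d n) (sb n) (sx n) ^ 2))} := by
  set ε : ℕ → ℝ := fun n => epsRate M₀ n (p n) (d n) (sb n) (sx n) with hεdef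
  have hC5 : 0 < C₅ := hC₁.trans hC₅
  -- The prior ball will have entrywise radius `η₀ / n`: column sums move by at most `η₀`, and `n²`
  -- times the squared log-odds error due to the positions stays bounded.
  obtain ⟨η₀, hη₀, hη1, hη2, hη3⟩ : ∃ η₀ : ℝ, 0 < η₀ ∧ η₀ ≤ C₅ - C₁ ∧ η₀ ≤ C₆ ∧ η₀ ≤ 1 :=
    ⟨min (C₅ - C₁) (min C₆ 1), lt_min (by linarith) (lt_min hC₆ one_pos), min_le_left _ _,
      (min_le_right _ _).trans (min_le_left _ _), (min_le_right _ _).trans (min_le_right _ _)⟩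
  have hD0 : 0 ≤ D := by
    obtain ⟨n, hn⟩ := hD.exists
    exact le_trans (by positivity) hn
  set e := ⌈C₂⌉₊ with he
  -- With `N = n p`, the entries of `B` are at most `N ^ (e + 1)` and those of `X - ZB` at most `N ^
  -- (e + 3)`; the remaining constants are absorbed by large `N`.
  set a := e + 4 with ha
  -- The first term pays for the prior mass of the positions, the `2` for that of the intercept with
  -- its constant `cβ`, and the last two for the chi-square divergence over the neighbourhood.
  set ρ : ℝ := 2 * ((8 * a + 30 : ℕ) : ℝ) / M₀ ^ 2 + 2 + 6 * c₄ ^ 2 + 6 * (D * (2 * C₅ * η₀)) ^ 2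
    with hρ
  set R := D * C₅ ^ 2 with hR
  set κ := affinityRate α R Cβ with hκ
  have hκ0 : 0 < κ := affinityRate_pos _ hα.1 hα.2 (by positivity)
  have hρ2 : 2 ≤ ρ := by
    have h1 : 0 ≤ 2 * ((8 * a + 30 : ℕ) : ℝ) / M₀ ^ 2 := by positivity
    have h2 : 0 ≤ 6 * c₄ ^ 2 := by positivity
    have h3 : 0 ≤ 6 * (D * (2 * C₅ * η₀)) ^ 2 := by positivity
    linarith
  set CL : ℝ := 4 * (5 * ρ + κ * Real.exp Cβ * (D * C₆ ^ 2) ^ 2) / κ with hCL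
  refine ⟨ρ, CL, by linarith, by positivity, ?_⟩
  have hV := tendsto_sq_mul_epsRate_sq hM₀ (sb := sb) (sx := sx) hd hp
  have hcast := tendsto_natCast_atTop_atTop (R := ℝ)
  have hsmall : ∀ᶠ n : ℕ in atTop, c₄ * ε n + D * (2 * C₅ * η₀) / n ≤ 1 := by
    have h1 : Tendsto (fun n : ℕ => c₄ * ε n + D * (2 * C₅ * η₀) / n) atTop (𝓝 (c₄ * 0 + 0)) :=
      (hε.const_mul c₄).add (tendsto_const_nhds.div_atTop hcast)
    rw [mul_zero, zero_add] at h1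
    exact h1.eventually_le_const one_pos
  have hcβV : ∀ᶠ n : ℕ in atTop, Real.exp (-((n : ℝ) ^ 2 * ε n ^ 2)) ≤ cβ :=
    (Real.tendsto_exp_neg_atTop_nhds_zero.comp hV).eventually_le_const hcβ
  filter_upwards [hB, hRE, hmass, hD, hsmall, hcβV, hV.eventually_ge_atTop 1,
    hcast.eventually_ge_atTop 2, hcast.eventually_ge_atTop CB,
    hcast.eventually_ge_atTop ((√CRE + 1) / η₀), hcast.eventually_ge_atTop (C₁ + √CRE),
    hcast.eventually_ge_atTop D] with n hBn hREn hmassn hDn hsmalln hcβn hV1 hn2 hnCB hnη hnC hnD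
  have hn0 : (0 : ℝ) < n := by linarith
  have hn : 0 < n := by exact_mod_cast hn0
  have hp1 : (1 : ℝ) ≤ p n := by exact_mod_cast hp n
  set N : ℕ := n * p n with hN
  have hNc : (N : ℝ) = n * p n := by rw [hN]; push_cast; ring
  have hnN : (n : ℝ) ≤ N := by rw [hNc]; exact le_mul_of_one_le_right hn0.le hp1
  have hpN : (p n : ℝ) ≤ N := by rw [hNc]; exact le_mul_of_one_le_left (by linarith) (by linarith)
  have hN1 : (1 : ℝ) ≤ N := by linarith
  have hN0 : (0 : ℝ) < N := by linarith
  have hlog : 0 < Real.log ((n : ℝ) * p n) := by rw [← hNc]; exact Real.log_pos (by linarith)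
  have hd0 : (0 : ℝ) < d n := by exact_mod_cast hd n
  set V := (n : ℝ) ^ 2 * ε n ^ 2 with hVdef
  have hVeq : V = M₀ ^ 2 * ((1 + (sb n : ℝ) + sx n) * d n * Real.log ((n : ℝ) * p n)) :=
    sq_mul_epsRate_sq M₀ _ _ _ hn (hp n)
  have hZ : ∀ i j, |Z n i j| ≤ √CRE * n := by
    intro i j
    refine (abs_entry_le_of_eigenvalue_bound (hd n) (by positivity) hREn i j).trans ?_
    rw [Real.sqrt_mul' _ hn0.le]
    refine mul_le_mul_of_nonneg_left ?_ (Real.sqrt_nonneg _)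
    rw [Real.sqrt_le_left hn0.le]
    exact le_self_pow₀ (by linarith) two_ne_zero
  have hpz : p n * (√CRE * n) = √CRE * N := by rw [hNc]; ring
  have hBN : ∀ j k, |B n j k| ≤ (N : ℝ) ^ (e + 1) := by
    intro j k
    refine (hBn j k).trans ?_
    have h1 : (p n : ℝ) ^ C₂ ≤ (N : ℝ) ^ e := by
      calc (p n : ℝ) ^ C₂ ≤ (p n : ℝ) ^ (e : ℝ) :=
            Real.rpow_le_rpow_of_exponent_le hp1 (Nat.le_ceil _)
        _ = (p n : ℝ) ^ e := Real.rpow_natCast _ _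
        _ ≤ _ := pow_le_pow_left₀ (by linarith) hpN e
    rw [pow_succ, mul_comm]
    -- No sign is assumed for `CB`; it is nonnegative because it bounds an absolute value.
    exact mul_le_mul h1 (hnCB.trans hnN) (by
      by_contra hneg
      push Not at hneg
      have h2 := (abs_nonneg _).trans (hBn j k)
      have h3 : 0 < (p n : ℝ) ^ C₂ := Real.rpow_pos_of_pos (by linarith) _
      exact absurd h2 (not_le.2 (mul_neg_of_neg_of_pos hneg h3))) (by positivity)
  have hU : ∀ i k, |X n i k - matMul (Z n) (B n) i k| ≤ (N : ℝ) ^ a := by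
    intro i k
    have h1 : |matMul (Z n) (B n) i k| ≤ √CRE * N * (N : ℝ) ^ (e + 1) := by
      rw [← hpz]
      refine (Finset.abs_sum_le_sum_abs _ _).trans ?_
      calc _ ≤ ∑ _j : Fin (p n), √CRE * n * (N : ℝ) ^ (e + 1) := by
            refine Finset.sum_le_sum fun j _ => ?_
            rw [abs_mul]
            exact mul_le_mul (hZ i j) (hBN j k) (abs_nonneg _) (by positivity)
        _ = _ := by simp; ring
    have h2 : (1 : ℝ) ≤ (N : ℝ) ^ (e + 2) := one_le_pow₀ hN1
    calc |X n i k - matMul (Z n) (B n) i k| ≤ C₁ + √CRE * N * (N : ℝ) ^ (e + 1) :=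
          (abs_sub _ _).trans (add_le_add (hXinf n i k) h1)
      _ ≤ C₁ * (N : ℝ) ^ (e + 2) + √CRE * (N : ℝ) ^ (e + 2) := by
          refine add_le_add (le_mul_of_one_le_right hC₁.le h2) (le_of_eq ?_)
          ring
      _ = (C₁ + √CRE) * (N : ℝ) ^ (e + 2) := by ring
      _ ≤ N * (N : ℝ) ^ (e + 2) := mul_le_mul_of_nonneg_right (hnC.trans hnN) (by positivity)
      _ = (N : ℝ) ^ (e + 3) := by ring
      _ ≤ _ := pow_le_pow_right₀ hN1 (by omega)
  have hη : (p n * (√CRE * n) + 1) * ((N : ℝ) ^ a)⁻¹ ≤ η₀ / n := by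
    rw [hpz, ← div_eq_mul_inv, div_le_div_iff₀ (by positivity) hn0]
    have h1 : √CRE + 1 ≤ η₀ * N := by
      rw [div_le_iff₀ hη₀] at hnη
      exact (hnη.trans (mul_le_mul_of_nonneg_right hnN hη₀.le)).trans_eq (mul_comm _ _)
    calc (√CRE * N + 1) * n ≤ ((√CRE + 1) * N) * N :=
          mul_le_mul (by rw [add_mul, one_mul]; linarith) hnN hn0.le (by positivity)
      _ ≤ (η₀ * N * N) * N := by gcongr
      _ = η₀ * (N : ℝ) ^ 3 := by ring
      _ ≤ η₀ * (N : ℝ) ^ a :=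
          mul_le_mul_of_nonneg_left (pow_le_pow_right₀ hN1 (by omega)) hη₀.le
  have hdD : d n * (2 * C₅ * (η₀ / n)) ≤ D * (2 * C₅ * η₀) / n := by
    calc d n * (2 * C₅ * (η₀ / n)) = d n * (2 * C₅ * η₀) / n := by ring
      _ ≤ _ := by gcongr
  have hr1 : 1 ≤ ρ * V := one_le_mul_of_one_le_of_one_le (by linarith) hV1
  have hpm := exp_neg_le_prior_mass (N := N) (k := 8 * a + 30) (m := (2 + sb n + sx n) * d n)
    (s := (1 + (sb n : ℝ) + sx n) * d n) (w := V / M₀ ^ 2) (by exact_mod_cast hN1) hcβn rfl (by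
      push_cast
      have h1 : (0 : ℝ) ≤ sb n := by positivity
      have h2 : (0 : ℝ) ≤ sx n := by positivity
      rw [← mul_assoc]
      exact mul_le_mul_of_nonneg_right (by linarith) hd0.le) (by
      rw [hVeq, hNc]
      field_simp)
  have hfinal := jointPrior_concentration (N := N) (a := a) hn (by exact_mod_cast hn2.trans hnN)
    (hd n) (by exact_mod_cast hpN) (by exact_mod_cast hnN)
    (by exact_mod_cast hDn.trans (hnD.trans hnN)) (Z n) (B n) (X n) (R := R) (β₀ := β n)
    (Cβ := Cβ) (r := ρ * V) (t := c₄ * ε n) (c₅ := C₅) (c₆ := C₆) hZ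
    (fun j k => (hBN j k).trans (pow_le_pow_right₀ hN1 (by omega))) hU (hsx n) (hsb n) hη
    (hXinf n) (hcent n)
    (by
      have : η₀ / n ≤ η₀ := div_le_self hη₀.le (by linarith)
      linarith)
    (by rw [mul_div_cancel₀ _ hn0.ne']; exact hη2) (by positivity) hα.1 hα.2
    (by rw [hR]; gcongr) (hβle n) hr1 (priorβ n) hmassn
    (by
      refine le_trans (Real.exp_le_exp.2 (neg_le_neg ?_)) hpm
      have h1 : 0 ≤ 6 * c₄ ^ 2 * V := by positivity
      have h2 : 0 ≤ 6 * (D * (2 * C₅ * η₀)) ^ 2 * V := by positivity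
      rw [hρ]
      calc _ = 2 * ((8 * a + 30 : ℕ) : ℝ) / M₀ ^ 2 * V + 2 * V := by ring
        _ ≤ _ := by linarith)
    (by linarith)
    (by
      have h1 : (c₄ * ε n + d n * (2 * C₅ * (η₀ / n))) ^ 2 ≤
          2 * (c₄ * ε n) ^ 2 + 2 * (D * (2 * C₅ * η₀) / n) ^ 2 := by
        have h2 : (d n * (2 * C₅ * (η₀ / n))) ^ 2 ≤ (D * (2 * C₅ * η₀) / n) ^ 2 :=
          pow_le_pow_left₀ (by positivity) hdD 2
        exact add_sq_le.trans (by linarith)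
      calc 3 * ((n : ℝ) ^ 2 * (c₄ * ε n + d n * (2 * C₅ * (η₀ / n))) ^ 2)
          ≤ 3 * ((n : ℝ) ^ 2 * (2 * (c₄ * ε n) ^ 2 + 2 * (D * (2 * C₅ * η₀) / n) ^ 2)) := by gcongr
        _ = 6 * c₄ ^ 2 * V + 6 * (D * (2 * C₅ * η₀)) ^ 2 * 1 := by
            rw [hVdef]
            field_simp
            ring
        _ ≤ 6 * c₄ ^ 2 * V + 6 * (D * (2 * C₅ * η₀)) ^ 2 * V := by gcongr
        _ ≤ ρ * V := by
            have h3 : 0 ≤ (2 * ((8 * a + 30 : ℕ) : ℝ) / M₀ ^ 2 + 2) * V := by positivity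
            rw [hρ]
            linarith)
  refine hfinal.trans (measureReal_mono fun Y hY U hU => ?_)
  have h1 := hY U hU
  have hloss : (n : ℝ) ^ 2 * innerProductLoss U (X n) = ∑ i, ∑ j, gramDiff U (X n) i j ^ 2 := by
    rw [innerProductLoss_eq]
    field_simp
  rw [hloss, ← hκ] at h1
  set Q := ∑ i, ∑ j, gramDiff U (X n) i j ^ 2
  have hdC : ((d n : ℝ) * C₆ ^ 2) ^ 2 ≤ (D * C₆ ^ 2) ^ 2 := by gcongr
  have hexp : Real.exp (β n) ≤ Real.exp Cβ := Real.exp_le_exp.2 (hβle n)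
  have h2 : κ * Real.exp (β n) * Q ≤ 4 * (5 * ρ + κ * Real.exp Cβ * (D * C₆ ^ 2) ^ 2) * V := by
    have h3 : κ * Real.exp (β n) * (d n * C₆ ^ 2) ^ 2 ≤ κ * Real.exp Cβ * (D * C₆ ^ 2) ^ 2 := by
      gcongr
    have h4 : 0 ≤ κ * Real.exp Cβ * (D * C₆ ^ 2) ^ 2 := by positivity
    refine h1.trans ?_
    calc 4 * (5 * (ρ * V) + κ * Real.exp (β n) * (d n * C₆ ^ 2) ^ 2)
        ≤ 4 * (5 * (ρ * V) + κ * Real.exp Cβ * (D * C₆ ^ 2) ^ 2 * V) :=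
          mul_le_mul_of_nonneg_left
            (add_le_add le_rfl (h3.trans (le_mul_of_one_le_right h4 hV1))) (by norm_num)
      _ = _ := by ring
  rw [hCL]
  calc Q = (κ * Real.exp (β n) * Q) * (Real.exp (-β n) / κ) := by
        rw [Real.exp_neg]
        field_simp
    _ ≤ (4 * (5 * ρ + κ * Real.exp Cβ * (D * C₆ ^ 2) ^ 2) * V) * (Real.exp (-β n) / κ) := by
        gcongr
    _ = _ := by ring

/-! ### The misclustering rate -/

theorem theorem2
    -- dimensions, sparsity levels and numbers of clusters, all depending on the number `n` of nodes
    (d p sb sx K : ℕ → ℕ)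
    (hd : ∀ n, 0 < d n) (hp : ∀ n, 0 < p n)
    -- constants
    (α M₀ C₁ C₁' C₂ CB C₅ C₆ cRE CRE RRE c₄ cβ Cβ CX : ℝ)
    (hα : 0 < α ∧ α < 1) (hM₀ : 0 < M₀)
    -- covariates, true positions, true coefficients, true intercept
    (Z : ∀ n, Mat n (p n)) (X : ∀ n, Mat n (d n)) (B : ∀ n, Mat (p n) (d n)) (β : ℕ → ℝ)
    -- sparsity structure of the truth
    (hsx : ∀ n, (Finset.univ.filter fun i => X n i ≠ matMul (Z n) (B n) i).card ≤ sx n)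
    (hsb : ∀ n, (Finset.univ.filter fun j => B n j ≠ 0).card ≤ sb n)
    -- the rate tends to zero and the number of covariates is at most polynomial
    (hε : Tendsto (fun n => epsRate M₀ n (p n) (d n) (sb n) (sx n)) atTop (𝓝 0))
    (hlogp : (fun n => Real.log (p n)) =O[atTop] fun n : ℕ => Real.log n)
    -- magnitude of the truth, in the maximum norm and in the Euclidean norm
    (hC₁ : 0 < C₁) (hXinf : ∀ n i k, |X n i k| ≤ C₁)
    (hX2 : ∀ n i, √(∑ k, X n i k ^ 2) ≤ C₁')
    (hC₂ : 0 < C₂) (hB : ∀ᶠ n in atTop, ∀ j k, |B n j k| ≤ CB * (p n : ℝ) ^ C₂)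
    -- restricted eigenvalues of the covariates
    (hcRE : 0 < cRE) (hCRE : 0 < CRE) (hRRE : 0 < RRE)
    (hRE : ∀ᶠ n : ℕ in atTop, ∀ A : Mat (p n) (d n),
      norm21 A ≤ RRE * ((1 + (sb n : ℝ)) * d n * Real.log ((n : ℝ) * p n)) →
      cRE * n * frobSq A ≤ frobSq (matMul (Z n) A) ∧
        frobSq (matMul (Z n) A) ≤ CRE * n * frobSq A)
    -- sparsity level of the network
    (hβ : (fun n => epsRate M₀ n (p n) (d n) (sb n) (sx n) ^ 2)
      =o[atTop] fun n => Real.exp (β n))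
    (hβle : ∀ n, β n ≤ Cβ)
    -- prior of the intercept
    (priorβ : ℕ → Measure ℝ) (hprior : ∀ n, IsProbabilityMeasure (priorβ n))
    (hc₄ : 0 < c₄) (hcβ : 0 < cβ)
    (hmass : ∀ᶠ n : ℕ in atTop,
      cβ * Real.exp (-((n : ℝ) ^ 2 * epsRate M₀ n (p n) (d n) (sb n) (sx n) ^ 2)) ≤
        (priorβ n).real {b | |b - β n| ≤ c₄ * epsRate M₀ n (p n) (d n) (sb n) (sx n)})
    -- identifiability, and the bounds that restrict the prior of the positions
    (hcent : ∀ n k, ∑ i, X n i k = 0)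
    (hC₅ : C₁ < C₅) (hC₆ : 0 < C₆)
    -- (1) cluster structure: K distinct rows, centers of full column rank
    (g : ∀ n, Fin n → Fin (K n)) (C : ∀ n, Mat (K n) (d n))
    (hXC : ∀ n i, X n i = C n (g n i))
    (hgsurj : ∀ᶠ n in atTop, Function.Surjective (g n))
    (hCinj : ∀ᶠ n in atTop, Function.Injective (C n))
    (hCrank : ∀ᶠ n in atTop, (Matrix.of (C n)).rank = d n)
    -- (2) smallest singular value of order at least √n
    (hCX : 0 < CX) (hsing : ∀ᶠ n : ℕ in atTop, CX * √(n : ℝ) ≤ smallestSingularValue (X n))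
    -- (3) cluster separation
    (δ : ℕ → ℝ) (hδ : ∀ n, 0 < δ n)
    (hsep : ∀ n i j, X n i ≠ X n j → δ n ≤ √(∑ k, (X n i k - X n j k) ^ 2))
    -- (4) minimal block size
    (hblock : (fun n : ℕ => (n : ℝ) * epsRate M₀ n (p n) (d n) (sb n) (sx n) ^ 2
        * Real.exp (-β n) / δ n ^ 2)
      =o[atTop] fun n => (minBlockSize (g n) : ℝ))
    -- the Bayes estimator, and K-means applied to it
    (Xhat : ∀ n, Network n → Mat n (d n))
    (hXhat : ∀ n Y, IsBayesEstimate
      (fractionalPosterior α (jointPrior (d n) (Z n) C₅ C₆ (priorβ n)) Y) (Xhat n Y))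
    (ghat : ∀ n, Network n → Fin n → Fin (K n))
    (hghat : ∀ n Y, IsKMeans (Xhat n Y) (ghat n Y)) :
    ∃ C₀ : ℝ, 0 < C₀ ∧
      Tendsto (fun n : ℕ => networkLaw (β n) (X n)
        {Y | (misclustered (ghat n Y) (g n) : ℝ) / n ≤
          C₀ * (Real.exp (-β n) * epsRate M₀ n (p n) (d n) (sb n) (sx n) ^ 2 / δ n ^ 2)})
        atTop (𝓝 1) := by
  have hdD : ∀ᶠ n in atTop, (d n : ℝ) ≤ C₁' ^ 2 / CX ^ 2 := by
    filter_upwards [hsing, eventually_gt_atTop 0] with n hn hn0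
    exact dim_mul_sq_le hn0 (hd n) hCX hn (hX2 n)
  obtain ⟨ρ, CL, hρ, hCL, hcontr⟩ := bayes_estimate_contraction d p sb sx hd hp hα hM₀ Z X B β
    hsx hsb hε hC₁ hXinf hB hRRE (hRE.mono fun n h A hA => (h A hA).2) hβle priorβ hprior hcβ hmass
    hcent hC₅ hC₆ hdD
  set ε : ℕ → ℝ := fun n => epsRate M₀ n (p n) (d n) (sb n) (sx n) with hεdef
  have hV := tendsto_sq_mul_epsRate_sq hM₀ (sb := sb) (sx := sx) hd hp
  have hC0 : 0 < 32 * CL / CX ^ 2 := by positivity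
  refine ⟨32 * CL / CX ^ 2, hC0, ?_⟩
  have hev : ∀ᶠ n : ℕ in atTop,
      ENNReal.ofReal (1 - 2 * Real.exp (-(ρ * ((n : ℝ) ^ 2 * ε n ^ 2)))) ≤
      networkLaw (β n) (X n) {Y | (misclustered (ghat n Y) (g n) : ℝ) / n ≤
          32 * CL / CX ^ 2 * (Real.exp (-β n) * ε n ^ 2 / δ n ^ 2)} := by
    -- The first constant gives `E ≤ σ² / 4` with `σ = CX² n`, as the alignment requires; the second
    -- makes the misclustering bound at most half of the smallest block.
    filter_upwards [hcontr, hsing, eventually_gt_atTop 0, hgsurj, hCinj,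
      hβ.bound (c := CX ^ 4 / (4 * CL)) (by positivity),
      hblock.bound (c := (2 * (32 * CL / CX ^ 2))⁻¹) (by positivity)]
      with n hcn hsn hn hgn hCn hβn hbn
    have hn0 : (0 : ℝ) < n := by exact_mod_cast hn
    rw [ENNReal.ofReal_le_iff_le_toReal (measure_ne_top _ _)]
    refine hcn.trans (measureReal_mono fun Y hY => ?_)
    have hE := hY _ (hXhat n Y)
    set E := CL * (Real.exp (-β n) * ((n : ℝ) ^ 2 * ε n ^ 2)) with hEdef
    have hδn := hδ n
    have hσ : ∀ u : Fin (d n) → ℝ, (CX ^ 2 * n) * (u ⬝ᵥ u) ≤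
        ((Matrix.of (X n)).mulVec u) ⬝ᵥ ((Matrix.of (X n)).mulVec u) := by
      intro u
      refine le_trans ?_ (smallestSingularValue_sq_mul_le (hd n) (X n) u)
      refine mul_le_mul_of_nonneg_right ?_ (dotProduct_self_nonneg' u)
      calc CX ^ 2 * n = (CX * √(n : ℝ)) ^ 2 := by rw [mul_pow, Real.sq_sqrt hn0.le]
        _ ≤ _ := pow_le_pow_left₀ (by positivity) hsn 2
    have hEσ : E ≤ (CX ^ 2 * n) ^ 2 / 4 := by
      rw [Real.norm_eq_abs, Real.norm_eq_abs, abs_of_nonneg (by positivity), Real.abs_exp] at hβn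
      calc E = CL * (Real.exp (-β n) * (n : ℝ) ^ 2) * ε n ^ 2 := by rw [hEdef]; ring
        _ ≤ CL * (Real.exp (-β n) * (n : ℝ) ^ 2) * (CX ^ 4 / (4 * CL) * Real.exp (β n)) := by gcongr
        _ = _ := by rw [Real.exp_neg]; field_simp
    obtain ⟨C', hC'⟩ := kmeans_centers_close (Xhat n Y) (X n) (g n) (ghat n Y) (C n) (hXC n)
      (hghat n Y) (by positivity) hσ hE hEσ
    have hT : 4 * (8 * (E / (CX ^ 2 * n))) / δ n ^ 2 =
        32 * CL / CX ^ 2 * (n * ε n ^ 2 * Real.exp (-β n) / δ n ^ 2) := by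
      rw [hEdef]
      field_simp
      ring
    have hmis := misclustered_le (X n) (g n) (ghat n Y) (C n) C' (hXC n) hCn hδn (hsep n) hC' (by
      rw [hT]
      -- A nonempty smallest block turns "at most half" into the strict inequality required.
      have h1 : (1 : ℝ) ≤ minBlockSize (g n) := by exact_mod_cast one_le_minBlockSize hn hgn
      rw [Real.norm_eq_abs, Real.norm_eq_abs, abs_of_nonneg (by positivity), Nat.abs_cast,
        ← div_eq_inv_mul, le_div_iff₀ (by positivity)] at hbn
      change n * ε n ^ 2 * Real.exp (-β n) / δ n ^ 2 * (2 * (32 * CL / CX ^ 2)) ≤ _ at hbn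
      linarith)
    rw [hT] at hmis
    simp only [Set.mem_ofPred_eq]
    rw [div_le_iff₀ hn0]
    refine hmis.trans (le_of_eq ?_)
    ring
  have hlim : Tendsto (fun n : ℕ =>
      ENNReal.ofReal (1 - 2 * Real.exp (-(ρ * ((n : ℝ) ^ 2 * ε n ^ 2))))) atTop (𝓝 1) := by
    have h1 : Tendsto (fun n : ℕ => 1 - 2 * Real.exp (-(ρ * ((n : ℝ) ^ 2 * ε n ^ 2)))) atTop
        (𝓝 (1 - 2 * 0)) :=
      ((Real.tendsto_exp_neg_atTop_nhds_zero.comp (hV.const_mul_atTop hρ)).const_mul 2).const_sub 1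
    rw [mul_zero, sub_zero] at h1
    simpa using ENNReal.tendsto_ofReal h1
  exact tendsto_of_tendsto_of_tendsto_of_le_of_le' hlim tendsto_const_nhds hev
    (Eventually.of_forall fun n => prob_le_one)
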